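/- **Setting.** Let $T\subset\mathbb Z^d$ be finite, $(X_i)_{i\in T}$ square-integrable real random variables on a common probability space (no centering and no assumption on their dependence), $\sigma^2:=\operatorname{Var}(\sum_{i\in T}X_i)>0$, $W(J):=\sigma^{-1}\sum_{i\in T\setminus J}X_i$ for $J\subseteq T$, and $W:=W(\emptyset)$. Fix a positive integer $m$ and a strict total order $\prec$ on $\mathbb Z^d$. Let $d(i,J)=\min_{j\in J}\|i-j\|_\infty$, $N(J)=\{i\in T: d(i,J)\le m\}$, and let $N^{(s)}(J)$ ($s\ge 0$) be $N(J)$ together with the first $s$ elements of $T\setminus N(J)$ (all of them if there are fewer than $s$), sorted by $d(\cdot,J)$ and then by $\prec$. **Genograms.** A genogram $G$ of order $|G|=k\ge1$ is a rooted tree with $k$ vertices and an integer $s_v$ (identifier) for each vertex $v$ such that: $s_v=0$ for the root, $s_v\ge-1$ for every $v$, $s_v\ge0$ if $v$ is a child of the root, and if a vertex has more than one child then the identifiers of its children are non-negative and mutually different. A vertex is negative if $s_v=-1$. The vertices carry their compatible labeling $v[1],\dots,v[k]$: depth-first traversal from the root, children of the same vertex being visited in decreasing order of their identifiers. Write $s_j$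 for the identifier of $v[j]$, $p(j)$ for the label of its parent, $A(j)$ for the label set of its ancestors, and $$g(j)=\max\bigl(\{1\}\cup\{\ell\in A(j):s_\ell\ge1\}\bigr),\qquad u(j)=\max\{\ell\in\{j\}\cup A(j):s_\ell\ge0\}.$$ $\mathcal G(k)$ is the set of genograms of order $k$; $\gamma_G$ is the number of leaves (childless vertices) and $\tau_G$ the number of negative vertices of $G$. $H\supseteq G$ means that $G$ is the genogram induced by $H$ on $v[1],\dots,v[|G|]$. **Constraint sets.** Given running indices $i_1,i_2,\dots$, put $B_1=T$, $D_1=\emptyset$ and, for $j\ge2$, with $I_j=\{i_\ell:\ell\in A(j)\}$, $$B_j=\begin{cases}N^{(s_j)}(I_j)\cup D_{g(j)}& s_j\ge0\\ B_{u(j)}&s_j=-1\end{cases},\qquad D_j=\begin{cases}N^{(s_j-1)}(I_j)\cup D_{g(j)}& s_j\ge1\\ D_{g(j)}&s_j\le0\end{cases}.$$ **Operators.** Let $\mathcal D^*(Y)=\mathbb E[Y]$, $\mathcal D(Y)=Y-\mathbb E[Y]$ and, for $t\ge2$, $\mathcal D^*(Y_1,\dots,Y_t)=\mathbb E[Y_1\mathcal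 D(Y_2,\dots,Y_t)]$, $\mathcal D(Y_1,\dots,Y_t)=Y_1\mathcal D(Y_2,\dots,Y_t)-\mathcal D^*(Y_1,\dots,Y_t)$; $\mathcal D^*(Y_1,\dots,Y_t)$ is well-defined if $\mathbb E|Y_i\cdots Y_j|<\infty$ for all $1\le i\le j\le t$. For $G\in\mathcal G(k)$ cut $1,\dots,k$ into branches, a new branch starting at $1$ and at every $j\ge 2$ with $p(j)\ne j-1$; cut every branch into blocks, a new block starting at its first label and at every further label $j$ with $s_j\ge0$. Then $\mathcal E_G(Y_1,\dots,Y_k)$ is the product over the branches of $\mathcal D^*(Z_1,\dots,Z_t)$, where $Z_1,\dots,Z_t$ are the products of the $Y_j$ over the successive blocks of the branch; it is well-defined if all these factors are. **The sums.** For $G\in\mathcal G(k)$ let $$\mathcal S(G)=\sigma^{-k}\sum_{i_1\in B_1\setminus D_1}\cdots\sum_{i_k\in B_k\setminus D_k}\mathcal E_G(X_{i_1},\dots,X_{i_k}),$$ $$\mathcal T_f(G)=\sigma^{-k}\sum_{i_1\in B_1\setminus D_1}\cdots\sum_{i_k\in B_k\setminus D_k}\mathcal E_G\bigl(X_{i_1},\dots,X_{i_{k-1}},X_{i_k}\,\partial^{k-1}f(W(D_k))\bigr),$$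 and, for $k\ge2$, $$\mathcal U_f(G)=\sigma^{-(k-1)}\sum_{i_1\in B_1\setminus D_1}\cdots\sum_{i_{k-1}\in B_{k-1}\setminus D_{k-1}}\mathcal E_G\bigl(X_{i_1},\dots,X_{i_{k-1}},\Delta_f(G)\bigr),$$ where $\Delta_f(G)=\partial^{k-2}f(W(B_k))-\partial^{k-2}f(W(D_k))$ if $u(k)=k$, and otherwise $$\Delta_f(G)=\int_0^1(k-u(k))\,v^{k-1-u(k)}\Bigl(\partial^{k-2}f\bigl(vW(D_k)+(1-v)W(B_k)\bigr)-\partial^{k-2}f\bigl(W(D_k)\bigr)\Bigr)\,dv .$$ **Theorem.** Let $G$ be a genogram, $k\ge|G|$ an integer and $f\in\mathcal C^{k-1}(\mathbb R)$. For $n\ge|G|$ let $\mathcal X_n$ be the set of all $H\in\mathcal G(n)$ such that $H\supseteq G$ and, if $n>|G|$, the vertex $v[|G|+1]$ of $H$ has identifier $s_{|G|+1}\ge0$. Assume that the expectations entering these quantities exist: $\mathbb E|\partial^{n-1}f(W)|<\infty$ for $|G|\le n\le k$, all summands of $\mathcal S(H)$ and $\mathcal T_f(H)$ are well-defined for $H\in\mathcal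 X_n$, $|G|\le n\le k$, and all summands of $\mathcal U_f(H)$ are well-defined for $H\in\mathcal X_n$, $|G|<n\le k+1$. Then only finitely many $H\in\bigcup_{|G|\le n\le k}\mathcal X_n$ have $\mathcal S(H)\ne0$, only finitely many $H\in\mathcal X_{k+1}$ have $\mathcal U_f(H)\neq0$, and $$\mathcal T_f(G)=\sum_{n=|G|}^{k}\ \sum_{H\in\mathcal X_n}a_{H,G}\,\mathcal S(H)\,\mathbb E\bigl[\partial^{|H|-1}f(W)\bigr]+\sum_{H\in\mathcal X_{k+1}}b_{H,G}\,\mathcal U_f(H),$$ where (empty products being $1$) $$a_{H,G}=(-1)^{\gamma_H-\gamma_G+\tau_H-\tau_G}\prod_{j=|G|+1}^{|H|}\frac1{j+1-u(j,H)},\qquad b_{H,G}=(-1)^{\gamma_H-\gamma_G+\tau_H-\tau_G+1}\prod_{j=|G|+1}^{|H|-1}\frac1{j+1-u(j,H)},$$ $u(j,H)$ being $u(j)$ for the genogram $H$. -/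

import Mathlib

open MeasureTheory ProbabilityTheory

/-! ## Genograms

A genogram of order `k` is a rooted tree with `k` vertices and an integer attached to every vertex.
Every genogram has exactly one compatible labelling `v[1], …, v[k]` of its vertices, so a genogram
is stored through the labels `1, …, k`: `p j` is the label of the parent of `v[j]` and `s j` is the
identifier of `v[j]`. The values at arguments that are not labels (and the parent of the root
`v[1]`) are set to `0`, so that two genograms are equal exactly when they have the same order, the
same parents and the same identifiers. -/

/-- The set `𝒢(k)` of all genograms of order `k`. -/
structure Genogram (k : ℕ) where
  /-- label of the parent -/
  p : ℕ → ℕ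
  /-- identifier -/
  s : ℕ → ℤ
  one_le_order : 1 ≤ k
  p_eq_zero : ∀ j, j ∉ Finset.Icc 2 k → p j = 0
  s_eq_zero : ∀ j, j ∉ Finset.Icc 1 k → s j = 0
  /-- Rooted tree: a vertex is labelled after its parent, only `v[1]` has no parent. -/
  p_mem : ∀ j ∈ Finset.Icc 2 k, 1 ≤ p j ∧ p j < j
  s_root : s 1 = 0
  neg_one_le_s : ∀ j ∈ Finset.Icc 2 k, -1 ≤ s j
  /-- The children of the root have non-negative identifiers. -/
  s_child_root : ∀ j ∈ Finset.Icc 2 k, p j = 1 → 0 ≤ s j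
  /-- Siblings have non-negative and mutually different identifiers. -/
  s_sibling : ∀ j ∈ Finset.Icc 2 k, ∀ h ∈ Finset.Icc 2 k, j ≠ h → p j = p h →
    0 ≤ s j ∧ 0 ≤ s h ∧ s j ≠ s h
  /-- Depth-first traversal: `v[j+1]` is a child of the vertex with the largest label `≤ j` that
  still has an unlabelled child. -/
  depth_first : ∀ j, 1 ≤ j → j + 1 ≤ k → ∀ l ∈ Finset.Icc (j + 1) k, p l ≤ j → p l ≤ p (j + 1)
  /-- Among siblings, a larger identifier means a smaller label. -/
  label_sibling : ∀ j ∈ Finset.Icc 2 k, ∀ h ∈ Finset.Icc 2 k, j ≠ h → p j = p h →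
    (s h < s j ↔ j < h)

namespace Genogram

variable {k : ℕ} (G : Genogram k)

/-- The label set `A(j)` of the ancestors of `v[j]`: all of `p j`, `p (p j)`, … that are labels. -/
def A (j : ℕ) : Finset ℕ := ((Finset.Icc 1 j).image fun t => G.p^[t] j).erase 0

/-- The progenitor label `g(j)`: the largest label of a positive ancestor of `v[j]`, and the label
`1` of the root if there is none. -/
def g (j : ℕ) : ℕ := (insert 1 ((G.A j).filter fun l => 1 ≤ G.s l)).sup id

/-- `u(j)`: the largest label in `{j} ∪ A(j)` of a non-negative vertex. -/
def u (j : ℕ) : ℕ := ((insert j (G.A j)).filter fun l => 0 ≤ G.s l).sup id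

/-- The number of leaves, i.e. of vertices that are not the parent of any vertex. -/
def leaves : ℕ := ((Finset.Icc 1 k).filter fun j => j ∉ (Finset.Icc 1 k).image G.p).card

/-- The number of negative vertices. -/
def negatives : ℕ := ((Finset.Icc 1 k).filter fun j => G.s j = -1).card

/-- `G ⊆ H`: `G` is the sub-genogram of `H` on the vertices `v[1], …, v[|G|]`. -/
def IsSub {n : ℕ} (G : Genogram k) (H : Genogram n) : Prop :=
  k ≤ n ∧ ∀ j ∈ Finset.Icc 1 k, H.p j = G.p j ∧ H.s j = G.s j

/-- The genograms `H ⊇ G` of order `n` for which the vertex `v[|G|+1]` of `H`, if there is one, is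
non-negative. -/
def extensions (n : ℕ) : Set (Genogram n) := {H | G.IsSub H ∧ (k < n → 0 ≤ H.s (k + 1))}

/-- The coefficient `a_{H,G}`. (Its value is `1` if `|H| = |G|`, the product being empty.) -/
noncomputable def coeffA {n : ℕ} (H : Genogram n) (G : Genogram k) : ℝ :=
  (-1 : ℝ) ^ ((H.leaves : ℤ) - G.leaves + H.negatives - G.negatives) *
    ∏ j ∈ Finset.Icc (k + 1) n, 1 / ((j : ℝ) + 1 - H.u j)

/-- The coefficient `b_{H,G}` for `|H| ≥ |G| + 1`. (The product is empty if `|H| = |G| + 1`.) -/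
noncomputable def coeffB {n : ℕ} (H : Genogram n) (G : Genogram k) : ℝ :=
  (-1 : ℝ) ^ ((H.leaves : ℤ) - G.leaves + H.negatives - G.negatives + 1) *
    ∏ j ∈ Finset.Icc (k + 1) (n - 1), 1 / ((j : ℝ) + 1 - H.u j)

lemma p_lt {j : ℕ} (hj : 0 < j) : G.p j < j := by
  by_cases h : j ∈ Finset.Icc 2 k
  · exact (G.p_mem j h).2
  · rw [G.p_eq_zero j h]; exact hj

lemma p_zero : G.p 0 = 0 := G.p_eq_zero 0 (by simp)

lemma iterate_p_lt {j : ℕ} (hj : 0 < j) (t : ℕ) : G.p^[t + 1] j < j := by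
  induction t with
  | zero => exact G.p_lt hj
  | succ t ih =>
    rw [Function.iterate_succ_apply']
    rcases Nat.eq_zero_or_pos (G.p^[t + 1] j) with h | h
    · rw [h, G.p_zero]; exact hj
    · exact (G.p_lt h).trans ih

lemma lt_of_mem_A {j l : ℕ} (hl : l ∈ G.A j) : l < j := by
  simp only [A, Finset.mem_erase, Finset.mem_image, Finset.mem_Icc] at hl
  obtain ⟨_, t, ⟨h1, h2⟩, rfl⟩ := hl
  obtain ⟨t, rfl⟩ := Nat.exists_eq_succ_of_ne_zero (Nat.pos_iff_ne_zero.mp h1)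
  exact G.iterate_p_lt (by omega) t

lemma g_lt {j : ℕ} (hj : 1 < j) : G.g j < j := by
  rw [g, Finset.sup_lt_iff (by simpa using (by omega : 0 < j))]
  intro l hl
  rcases Finset.mem_insert.mp hl with rfl | hl
  · exact hj
  · exact G.lt_of_mem_A (Finset.mem_filter.mp hl).1

lemma u_lt {j : ℕ} (hj : 0 < j) (hs : G.s j < 0) : G.u j < j := by
  rw [u, Finset.sup_lt_iff (by simpa using hj)]
  intro l hl
  obtain ⟨hl, hl0⟩ := Finset.mem_filter.mp hl
  rcases Finset.mem_insert.mp hl with rfl | hl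
  · omega
  · exact G.lt_of_mem_A hl

/-! ### The operator attached to a genogram -/

/-- The branches of `G`, as lists of consecutive labels: a new branch starts at every `v[j]` whose
parent is not `v[j-1]`. -/
def branches : List (List ℕ) :=
  (List.range' 1 k).splitBy fun a b => decide (G.p b = a)

/-- The blocks of a branch: a new block starts at every non-negative vertex of the branch. -/
def blocks (br : List ℕ) : List (List ℕ) :=
  br.splitBy fun _ b => decide (G.s b < 0)

/-- The products of `Y` over the blocks of a branch. -/
def blockProducts {Ω : Type*} (Y : ℕ → Ω → ℝ) (br : List ℕ) : List (Ω → ℝ) :=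
  (G.blocks br).map fun bl ω => (bl.map fun t => Y t ω).prod

end Genogram

/-! ## Generalized covariances -/

section Covariance

variable {Ω : Type*} [MeasurableSpace Ω] (μ : Measure Ω)

/-- The operator `𝒟`: `𝒟(Y) = Y - E[Y]` and
`𝒟(Y₁, …, Yₜ) = Y₁ 𝒟(Y₂, …, Yₜ) - E[Y₁ 𝒟(Y₂, …, Yₜ)]`. The value `1` at the empty sequence is a
convention that makes the second formula contain the first. -/
noncomputable def calD : List (Ω → ℝ) → Ω → ℝ
  | [] => fun _ => 1
  | Y :: L => fun ω => Y ω * calD L ω - ∫ ω', Y ω' * calD L ω' ∂μ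

/-- The generalized covariance `𝒟*`: `𝒟*(Y) = E[Y]`, `𝒟*(Y₁, …, Yₜ) = E[Y₁ 𝒟(Y₂, …, Yₜ)]`. -/
noncomputable def calDstar : List (Ω → ℝ) → ℝ
  | [] => 1
  | Y :: L => ∫ ω, Y ω * calD μ L ω ∂μ

/-- `𝒟*(Y₁, …, Yₜ)` is well-defined: `E|Yᵢ ⋯ Yⱼ| < ∞` for all `i ≤ j`. -/
def DstarDefined (L : List (Ω → ℝ)) : Prop :=
  ∀ L' : List (Ω → ℝ), L' <:+: L → Integrable (fun ω => (L'.map fun Y => Y ω).prod) μ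

/-- The operator `ℰ_G(Y₁, …, Y_k)`: the product over the branches of `G` of the `𝒟*` of the
products over the blocks of the branch. -/
noncomputable def Genogram.calE {k : ℕ} (G : Genogram k) (Y : ℕ → Ω → ℝ) : ℝ :=
  (G.branches.map fun br => calDstar μ (G.blockProducts Y br)).prod

/-- `ℰ_G(Y₁, …, Y_k)` is well-defined: all its `𝒟*` factors are. -/
def Genogram.EDefined {k : ℕ} (G : Genogram k) (Y : ℕ → Ω → ℝ) : Prop :=
  ∀ br ∈ G.branches, DstarDefined μ (G.blockProducts Y br)

end Covariance

/-! ## Neighbourhoods in a finite index set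

`T` is a finite subset of `ℤ^d`, `m` a natural number and `r` a strict total order on `ℤ^d`. The
distance on `Fin d → ℤ` is that of the maximum norm. -/

section Neighbourhoods

variable {d : ℕ} (T : Finset (Fin d → ℤ)) (m : ℕ) (r : (Fin d → ℤ) → (Fin d → ℤ) → Prop)

open Classical in
/-- The neighbourhood `N(J)`. -/
noncomputable def nbhd (J : Finset (Fin d → ℤ)) : Finset (Fin d → ℤ) :=
  T.filter fun i => Metric.infDist i (J : Set (Fin d → ℤ)) ≤ m

open Classical in
/-- `rk(i, J)`: the position of `i` when `T \ N(J)` is sorted by the distance from `J`, and by `r`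
among the points at the same distance. -/
noncomputable def rk (J : Finset (Fin d → ℤ)) (i : Fin d → ℤ) : ℕ :=
  ((T \ nbhd T m J).filter fun i' =>
    Metric.infDist i' (J : Set (Fin d → ℤ)) < Metric.infDist i (J : Set (Fin d → ℤ)) ∨
      (Metric.infDist i' (J : Set (Fin d → ℤ)) = Metric.infDist i (J : Set (Fin d → ℤ)) ∧
        (r i' i ∨ i' = i))).card

open Classical in
/-- `N^{(s)}(J)`: `N(J)` together with the first `s` points of `T \ N(J)`. -/
noncomputable def nbhdS (s : ℤ) (J : Finset (Fin d → ℤ)) : Finset (Fin d → ℤ) :=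
  T.filter fun i => i ∈ nbhd T m J ∨ (rk T m r J i : ℤ) ≤ s

namespace Genogram

variable {k : ℕ} (G : Genogram k)

open Classical in
/-- The inner constraint set `D_j`, given the running indices `i`; it only depends on `i l` for
`l < j`. -/
noncomputable def inner (i : ℕ → Fin d → ℤ) (j : ℕ) : Finset (Fin d → ℤ) :=
  if h : j ≤ 1 then ∅
  else if 1 ≤ G.s j then
    nbhdS T m r (G.s j - 1) ((G.A j).image i) ∪ inner i (G.g j)
  else inner i (G.g j)
termination_by j
decreasing_by all_goals exact G.g_lt (by omega)

open Classical in
/-- The outer constraint set `B_j`, given the running indices `i`; it only depends on `i l` for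
`l < j`. -/
noncomputable def outer (i : ℕ → Fin d → ℤ) (j : ℕ) : Finset (Fin d → ℤ) :=
  if _h : j ≤ 1 then T
  else if _hs : G.s j < 0 then outer i (G.u j)
  else nbhdS T m r (G.s j) ((G.A j).image i) ∪ G.inner T m r i (G.g j)
termination_by j
decreasing_by exact G.u_lt (by omega) _hs

/-- The range `B_j \ D_j` of the running index `i_j`. -/
noncomputable def idxRange (i : ℕ → Fin d → ℤ) (j : ℕ) : Finset (Fin d → ℤ) :=
  G.outer T m r i j \ G.inner T m r i j

/-- Auxiliary iterated sum: the running indices `i_j, …, i_{j+n-1}` are summed, the running indices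
`i_1, …, i_{j-1}` are those of `i`. -/
noncomputable def iterSumFrom (F : (ℕ → Fin d → ℤ) → ℝ) : ℕ → ℕ → (ℕ → Fin d → ℤ) → ℝ
  | _, 0, i => F i
  | j, n + 1, i => ∑ x ∈ G.idxRange T m r i j, iterSumFrom F (j + 1) n (Function.update i j x)

/-- The iterated sum `∑_{i_1 ∈ B_1 \ D_1} ⋯ ∑_{i_n ∈ B_n \ D_n} F(i_1, …, i_n)`. -/
noncomputable def iterSum (n : ℕ) (F : (ℕ → Fin d → ℤ) → ℝ) : ℝ :=
  G.iterSumFrom T m r F 1 n fun _ => 0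

/-- `(i_1, …, i_n)` is one of the tuples that occur in the iterated sum. -/
def Admissible (n : ℕ) (i : ℕ → Fin d → ℤ) : Prop :=
  ∀ j ∈ Finset.Icc 1 n, i j ∈ G.idxRange T m r i j

end Genogram

end Neighbourhoods

/-! ## The sums attached to a genogram -/

section Sums

variable {Ω : Type*} [MeasurableSpace Ω] (μ : Measure Ω) {d : ℕ} (T : Finset (Fin d → ℤ))
  (X : (Fin d → ℤ) → Ω → ℝ)

/-- `σ`, the standard deviation of `∑_{i ∈ T} X_i`. -/
noncomputable def fieldSigma : ℝ := Real.sqrt (variance (fun ω => ∑ i ∈ T, X i ω) μ)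

/-- `W(J) = σ⁻¹ ∑_{i ∈ T \ J} X_i`; in particular `W = W(∅)`. -/
noncomputable def fieldW (J : Finset (Fin d → ℤ)) (ω : Ω) : ℝ :=
  (fieldSigma μ T X)⁻¹ * ∑ i ∈ T \ J, X i ω

variable (m : ℕ) (r : (Fin d → ℤ) → (Fin d → ℤ) → Prop) (f : ℝ → ℝ)

namespace Genogram

variable {k : ℕ} (G : Genogram k)

/-- The adjusted `f`-difference `Δ_f(G)`, for `|G| = k ≥ 2`. -/
noncomputable def adjDiff (i : ℕ → Fin d → ℤ) (ω : Ω) : ℝ :=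
  if G.u k = k then
    iteratedDeriv (k - 2) f (fieldW μ T X (G.outer T m r i k) ω) -
      iteratedDeriv (k - 2) f (fieldW μ T X (G.inner T m r i k) ω)
  else
    ∫ v in (0 : ℝ)..1, ((k : ℝ) - G.u k) * v ^ (k - 1 - G.u k) *
      (iteratedDeriv (k - 2) f
          (v * fieldW μ T X (G.inner T m r i k) ω +
            (1 - v) * fieldW μ T X (G.outer T m r i k) ω) -
        iteratedDeriv (k - 2) f (fieldW μ T X (G.inner T m r i k) ω))

/-- The arguments `X_{i_1}, …, X_{i_k}` of `ℰ_G` in `𝒮(G)`. -/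
def argS (i : ℕ → Fin d → ℤ) : ℕ → Ω → ℝ := fun j => X (i j)

/-- The arguments `X_{i_1}, …, X_{i_{k-1}}, X_{i_k} ∂^{k-1}f(W(D_k))` of `ℰ_G` in `𝒯_f(G)`. -/
noncomputable def argT (i : ℕ → Fin d → ℤ) : ℕ → Ω → ℝ :=
  Function.update (argS X i) k fun ω =>
    X (i k) ω * iteratedDeriv (k - 1) f (fieldW μ T X (G.inner T m r i k) ω)

/-- The arguments `X_{i_1}, …, X_{i_{k-1}}, Δ_f(G)` of `ℰ_G` in `𝒰_f(G)`. -/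
noncomputable def argU (i : ℕ → Fin d → ℤ) : ℕ → Ω → ℝ :=
  Function.update (argS X i) k (G.adjDiff μ T X m r f i)

/-- `𝒮(G)`. -/
noncomputable def sumS : ℝ :=
  ((fieldSigma μ T X)⁻¹) ^ k * G.iterSum T m r k fun i => G.calE μ (argS X i)

/-- `𝒯_f(G)`. -/
noncomputable def sumT : ℝ :=
  ((fieldSigma μ T X)⁻¹) ^ k * G.iterSum T m r k fun i => G.calE μ (G.argT μ T X m r f i)

/-- `𝒰_f(G)`, for `|G| = k ≥ 2`. -/
noncomputable def sumU : ℝ :=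
  ((fieldSigma μ T X)⁻¹) ^ (k - 1) *
    G.iterSum T m r (k - 1) fun i => G.calE μ (G.argU μ T X m r f i)

/-- All the summands of `𝒮(G)` are well-defined. -/
def SDefined : Prop := ∀ i, G.Admissible T m r k i → G.EDefined μ (argS X i)

/-- All the summands of `𝒯_f(G)` are well-defined. -/
def TDefined : Prop := ∀ i, G.Admissible T m r k i → G.EDefined μ (G.argT μ T X m r f i)

/-- All the summands of `𝒰_f(G)` are well-defined. -/
def UDefined : Prop := ∀ i, G.Admissible T m r (k - 1) i → G.EDefined μ (G.argU μ T X m r f i)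

end Genogram

end Sums

/-!
The expansion is obtained by iterating two identities, in which `H` is a genogram of order `h`.

*First identity* (`Genogram.sumT_eq`). Write `F = ∂^{h-1} f`. In a summand of `𝒯_f(H)` the last
argument carries the factor `F(W(D_h))`. When the identifier of a prospective child of `v[q]` runs
through `0, 1, 2, …`, the outer constraint set of one child is the inner constraint set of the next,
so the differences `F(W(B)) - F(W(D))` telescope. Over the children of `v[h]` they add up to
`F(0) - F(W(D_h))` (`Genogram.sum_levelDiff_child`), since the constraint sets grow up to `T`.
A new vertex that is not a child of `v[h]` must be a younger sibling of a vertex `v[c]` on the path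
from the root to `v[h]`, with an identifier below `s_c`; for fixed `c` the differences add up to
`F(W(D_c)) - F(W(D_{p(c)}))`, and over the whole path to `F(W(D_h)) - F(W)`
(`Genogram.sum_levelDiff_path`). As the last argument `Y_h F(W(D_h))` of `ℰ_H` is an affine
combination of the first family of differences and `F(W)` one of both, linearity of `ℰ_H` in its
last argument (`Genogram.calE_update_sum`), together with the effect of a new vertex on `ℰ_H`
(`Genogram.IsSub.calE_of_child`, `Genogram.IsSub.calE_of_branch`), gives
`𝒯_f(H) = 𝒮(H) E[F(W)] ± ∑ 𝒰_f(K)` over the `K ⊇ H` with one more, non-negative vertex; the sign is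
`-` for a child of `v[h]` and `+` for a new branch.

*Second identity* (`Genogram.IsSub.sumU_eq`). Integration by parts along the segment from `W(B_h)`
to `W(D_h)`, whose increment is `σ⁻¹ ∑_{i ∈ B_h \ D_h} X_i`, gives
`𝒰_f(H) = -(h + 1 - u(h))⁻¹ (𝒯_f(H) + 𝒰_f(K))`, where `K` is `H` with a negative vertex appended.

Appending to `H` all possible last vertices, negative or not, produces every genogram of order
`h + 1` that contains `H`, and each exactly once; so substituting both identities into the terms
`𝒰_f(H)` of the expansion up to `k` yields the expansion up to `k + 1`, with the coefficients
matching by `Genogram.coeffB_of_nonneg`, `Genogram.coeffB_of_neg` and `Genogram.coeffA_eq`.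
Genograms with an identifier above the number of sites contribute nothing, because then
`D_j = B_j = T` for some `j`; this makes all sums finite.
-/

/-! ### Splitting a list with one more element -/

namespace List

variable {α : Type*}

lemma splitBy_concat_of_rel {R : α → α → Bool} {l br : List α} {pre : List (List α)} {a b : α}
    (h : l.splitBy R = pre ++ [br ++ [a]]) (hab : R a b = true) :
    (l ++ [b]).splitBy R = pre ++ [br ++ [a] ++ [b]] := by
  rw [splitBy_eq_iff] at h ⊢
  obtain ⟨h1, h2, h3, h4⟩ := h
  refine ⟨by simp [h1], ?_, ?_, ?_⟩
  · simpa using h2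
  · intro m hm
    rcases mem_append.1 hm with hm | hm
    · exact h3 m (by simp [hm])
    · obtain rfl := mem_singleton.1 hm
      refine IsChain.append (h3 (br ++ [a]) (by simp)) (by simp) ?_
      simpa using hab
  · rw [isChain_append] at h4 ⊢
    refine ⟨h4.1, by simp, ?_⟩
    intro x hx y hy
    obtain ⟨ha, hb, hr⟩ := h4.2.2 x hx _ rfl
    simp only [head?_cons, Option.mem_def, Option.some.injEq] at hy
    subst hy
    refine ⟨ha, by simp, ?_⟩
    rw [head_append_of_ne_nil hb]
    exact hr

lemma splitBy_concat_of_not_rel {R : α → α → Bool} {l : List α} {a b : α}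
    (h : l.getLast? = some a) (hab : R a b = false) :
    (l ++ [b]).splitBy R = l.splitBy R ++ [[b]] := by
  rw [splitBy_append_cons]
  · rfl
  · intro x hx
    rw [h] at hx
    obtain rfl : a = x := by simpa using hx
    exact hab

/-- The last group of a split list ends with the last element of the list. -/
lemma exists_splitBy_concat (R : α → α → Bool) (l : List α) (a : α) :
    ∃ pre br, (l ++ [a]).splitBy R = pre ++ [br ++ [a]] := by
  have hne : (l ++ [a]).splitBy R ≠ [] := by simp
  have hg := getLast_getLast_splitBy R (l := l ++ [a]) (by simp)
  refine ⟨((l ++ [a]).splitBy R).dropLast, (((l ++ [a]).splitBy R).getLast hne).dropLast, ?_⟩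
  conv_lhs => rw [← dropLast_append_getLast hne]
  congr 2
  conv_lhs => rw [← dropLast_append_getLast (ne_nil_of_mem_splitBy (getLast_mem hne)), hg]
  simp

lemma splitBy_congr {R R' : α → α → Bool} {l : List α}
    (h : ∀ a ∈ l, ∀ b ∈ l, R a b = R' a b) : l.splitBy R = l.splitBy R' := by
  induction l using reverseRecOn with
  | nil => rfl
  | append_singleton l b ih =>
    have ih := ih fun a ha c hc => h a (by simp [ha]) c (by simp [hc])
    rcases eq_nil_or_concat l with rfl | ⟨l', a, rfl⟩
    · rfl
    · simp only [concat_eq_append] at h ih ⊢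
      have hab := h a (by simp) b (by simp)
      cases hR : R a b
      · rw [splitBy_concat_of_not_rel (l := l' ++ [a]) (a := a) (by simp) hR,
          splitBy_concat_of_not_rel (l := l' ++ [a]) (a := a) (by simp) (hab.symm.trans hR), ih]
      · obtain ⟨pre, br, hp⟩ := exists_splitBy_concat R l' a
        rw [splitBy_concat_of_rel hp hR,
          splitBy_concat_of_rel (ih.symm.trans hp) (hab.symm.trans hR)]

lemma mem_of_mem_splitBy {R : α → α → Bool} {l m : List α} {a : α} (hm : m ∈ l.splitBy R)
    (ha : a ∈ m) : a ∈ l := by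
  rw [← flatten_splitBy R l]
  exact mem_flatten.2 ⟨m, hm, ha⟩

end List

/-! ### Recursive description of ancestors and constraint sets -/

namespace Genogram

variable {k : ℕ} (G : Genogram k)

lemma iterate_p_le (j t : ℕ) : G.p^[t] j ≤ j - t := by
  induction t with
  | zero => simp
  | succ t ih =>
    rw [Function.iterate_succ_apply']
    rcases Nat.eq_zero_or_pos (G.p^[t] j) with h | h
    · rw [h, G.p_zero]; omega
    · have := G.p_lt h; omega

lemma mem_A {j x : ℕ} : x ∈ G.A j ↔ x ≠ 0 ∧ ∃ t, 1 ≤ t ∧ G.p^[t] j = x := by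
  simp only [A, Finset.mem_erase, Finset.mem_image, Finset.mem_Icc]
  refine and_congr_right fun hx => ⟨?_, ?_⟩
  · rintro ⟨t, ht, rfl⟩
    exact ⟨t, ht.1, rfl⟩
  · rintro ⟨t, ht, rfl⟩
    refine ⟨t, ⟨ht, ?_⟩, rfl⟩
    have := G.iterate_p_le j t
    omega

lemma A_eq {j : ℕ} (hj : G.p j ≠ 0) : G.A j = insert (G.p j) (G.A (G.p j)) := by
  ext x
  simp only [Finset.mem_insert, mem_A]
  constructor
  · rintro ⟨hx, t, ht, rfl⟩
    obtain ⟨t, rfl⟩ := Nat.exists_eq_succ_of_ne_zero (Nat.one_le_iff_ne_zero.1 ht)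
    rcases Nat.eq_zero_or_pos t with rfl | h
    · exact Or.inl rfl
    · exact Or.inr ⟨hx, t, h, rfl⟩
  · rintro (rfl | ⟨hx, t, ht, rfl⟩)
    · exact ⟨hj, 1, le_rfl, rfl⟩
    · exact ⟨hx, t + 1, by omega, rfl⟩

lemma A_eq_empty {j : ℕ} (hj : G.p j = 0) : G.A j = ∅ := by
  ext x
  simp only [mem_A, Finset.notMem_empty, iff_false, not_and, not_exists]
  rintro hx t ht rfl
  obtain ⟨t, rfl⟩ := Nat.exists_eq_succ_of_ne_zero (Nat.one_le_iff_ne_zero.1 ht)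
  apply hx
  rw [Function.iterate_succ_apply, hj]
  exact Function.iterate_fixed G.p_zero t

lemma p_one : G.p 1 = 0 := G.p_eq_zero 1 (by simp)

lemma A_one : G.A 1 = ∅ := G.A_eq_empty G.p_one

lemma p_pos {j : ℕ} (h2 : 2 ≤ j) (hk : j ≤ k) : 1 ≤ G.p j :=
  (G.p_mem j (Finset.mem_Icc.2 ⟨h2, hk⟩)).1

lemma p_lt' {j : ℕ} (h2 : 2 ≤ j) : G.p j < j := G.p_lt (by omega)

lemma A_eq' {j : ℕ} (h2 : 2 ≤ j) (hk : j ≤ k) : G.A j = insert (G.p j) (G.A (G.p j)) :=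
  G.A_eq (by have := G.p_pos h2 hk; omega)

lemma g_one : G.g 1 = 1 := by simp [g, A_one]

lemma g_eq {j : ℕ} (h2 : 2 ≤ j) (hk : j ≤ k) :
    G.g j = if 1 ≤ G.s (G.p j) then G.p j else G.g (G.p j) := by
  have hp := G.p_pos h2 hk
  rw [g, G.A_eq' h2 hk, Finset.filter_insert]
  split_ifs with h
  · apply le_antisymm
    · apply Finset.sup_le
      intro x hx
      simp only [Finset.mem_insert, Finset.mem_filter] at hx
      rcases hx with rfl | rfl | hx
      · exact hp
      · exact le_rfl
      · exact (G.lt_of_mem_A hx.1).le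
    · exact Finset.le_sup (f := id) (by simp)
  · rfl

lemma u_of_nonneg {j : ℕ} (h : 0 ≤ G.s j) : G.u j = j := by
  apply le_antisymm
  · apply Finset.sup_le
    intro x hx
    simp only [Finset.mem_insert, Finset.mem_filter] at hx
    rcases hx.1 with rfl | hx
    · exact le_rfl
    · exact (G.lt_of_mem_A hx).le
  · exact Finset.le_sup (f := id) (by simp [h])

lemma u_of_neg {j : ℕ} (h2 : 2 ≤ j) (hk : j ≤ k) (h : G.s j < 0) : G.u j = G.u (G.p j) := by
  rw [u, G.A_eq' h2 hk, Finset.filter_insert, if_neg (by omega), u]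

lemma u_le (j : ℕ) : G.u j ≤ j := by
  apply Finset.sup_le
  intro x hx
  simp only [Finset.mem_insert, Finset.mem_filter] at hx
  rcases hx.1 with rfl | hx
  · exact le_rfl
  · exact (G.lt_of_mem_A hx).le

variable {d : ℕ} (T : Finset (Fin d → ℤ)) (m : ℕ) (r : (Fin d → ℤ) → (Fin d → ℤ) → Prop)
  (i : ℕ → Fin d → ℤ)

lemma inner_one : G.inner T m r i 1 = ∅ := by
  rw [inner, dif_pos le_rfl]

lemma inner_g {j : ℕ} (h2 : 2 ≤ j) (hk : j ≤ k) :
    G.inner T m r i (G.g j) = G.inner T m r i (G.p j) := by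
  rw [G.g_eq h2 hk]
  split_ifs with h
  · rfl
  · rcases Nat.lt_or_ge 1 (G.p j) with h1 | h1
    · conv_rhs => rw [inner, dif_neg (by omega), if_neg h]
    · rw [show G.p j = 1 from le_antisymm h1 (G.p_pos h2 hk), g_one]

open Classical in
lemma inner_eq {j : ℕ} (h2 : 2 ≤ j) (hk : j ≤ k) :
    G.inner T m r i j =
      if 1 ≤ G.s j then nbhdS T m r (G.s j - 1) ((G.A j).image i) ∪ G.inner T m r i (G.p j)
      else G.inner T m r i (G.p j) := by
  rw [inner, dif_neg (by omega), G.inner_g T m r i h2 hk]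

lemma outer_one : G.outer T m r i 1 = T := by
  rw [outer, dif_pos le_rfl]

lemma s_one : G.s 1 = 0 := G.s_root

open Classical in
lemma outer_of_nonneg {j : ℕ} (h2 : 2 ≤ j) (hk : j ≤ k) (hs : 0 ≤ G.s j) :
    G.outer T m r i j = nbhdS T m r (G.s j) ((G.A j).image i) ∪ G.inner T m r i (G.p j) := by
  rw [outer, dif_neg (by omega), dif_neg (by omega), G.inner_g T m r i h2 hk]

lemma outer_of_neg {j : ℕ} (h2 : 2 ≤ j) (hk : j ≤ k) (hs : G.s j < 0) :
    G.outer T m r i j = G.outer T m r i (G.p j) := by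
  rw [outer, dif_neg (by omega), dif_pos hs, G.u_of_neg h2 hk hs]
  have hp := G.p_pos h2 hk
  rcases lt_or_ge (G.s (G.p j)) 0 with h | h
  · have h1 : ¬ G.p j ≤ 1 := by
      intro h1
      rw [show G.p j = 1 from le_antisymm h1 hp, G.s_one] at h
      omega
    conv_rhs => rw [outer, dif_neg h1, dif_pos h]
  · rw [G.u_of_nonneg h]

lemma inner_of_neg {j : ℕ} (h2 : 2 ≤ j) (hk : j ≤ k) (hs : G.s j < 0) :
    G.inner T m r i j = G.inner T m r i (G.p j) := by
  rw [G.inner_eq T m r i h2 hk, if_neg (by omega)]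

lemma nbhdS_subset (s : ℤ) (J : Finset (Fin d → ℤ)) : nbhdS T m r s J ⊆ T :=
  Finset.filter_subset _ _

lemma nbhdS_mono {s s' : ℤ} (h : s ≤ s') (J : Finset (Fin d → ℤ)) :
    nbhdS T m r s J ⊆ nbhdS T m r s' J := by
  intro x hx
  simp only [nbhdS, Finset.mem_filter] at hx ⊢
  exact ⟨hx.1, hx.2.imp_right fun h' => h'.trans h⟩

lemma nbhdS_eq_self {s : ℤ} (h : (T.card : ℤ) ≤ s) (J : Finset (Fin d → ℤ)) :
    nbhdS T m r s J = T := by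
  refine Finset.filter_true_of_mem fun x _ => Or.inr ?_
  refine le_trans ?_ h
  classical
  exact_mod_cast Finset.card_le_card ((Finset.filter_subset _ _).trans Finset.sdiff_subset)

variable {j : ℕ}

lemma inner_subset (h1 : 1 ≤ j) (hk : j ≤ k) : G.inner T m r i j ⊆ T := by
  induction j using Nat.strong_induction_on with
  | _ j ih =>
  rcases Nat.lt_or_ge 1 j with h2 | h2
  · have ihp := ih _ (G.p_lt' h2) (G.p_pos h2 hk) ((G.p_lt' h2).le.trans hk)
    rw [G.inner_eq T m r i h2 hk]
    split_ifs
    · exact Finset.union_subset (nbhdS_subset ..) ihp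
    · exact ihp
  · rw [show j = 1 by omega, inner_one]
    exact Finset.empty_subset _

lemma outer_subset (h1 : 1 ≤ j) (hk : j ≤ k) : G.outer T m r i j ⊆ T := by
  induction j using Nat.strong_induction_on with
  | _ j ih =>
  rcases Nat.lt_or_ge 1 j with h2 | h2
  · have hp := G.p_pos h2 hk
    have hlt := G.p_lt' h2
    rcases lt_or_ge (G.s j) 0 with h | h
    · rw [G.outer_of_neg T m r i h2 hk h]
      exact ih _ hlt hp (hlt.le.trans hk)
    · rw [G.outer_of_nonneg T m r i h2 hk h]
      exact Finset.union_subset (nbhdS_subset ..) (G.inner_subset T m r i hp (hlt.le.trans hk))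
  · rw [show j = 1 by omega, outer_one]

lemma inner_subset_outer (h1 : 1 ≤ j) (hk : j ≤ k) :
    G.inner T m r i j ⊆ G.outer T m r i j := by
  induction j using Nat.strong_induction_on with
  | _ j ih =>
  rcases Nat.lt_or_ge 1 j with h2 | h2
  · have hp := G.p_pos h2 hk
    have hlt := G.p_lt' h2
    rcases lt_or_ge (G.s j) 0 with h | h
    · rw [G.outer_of_neg T m r i h2 hk h, G.inner_of_neg T m r i h2 hk h]
      exact ih _ hlt hp (hlt.le.trans hk)
    · rw [G.outer_of_nonneg T m r i h2 hk h, G.inner_eq T m r i h2 hk]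
      split_ifs
      · exact Finset.union_subset_union (nbhdS_mono T m r (by omega) _) subset_rfl
      · exact Finset.subset_union_right
  · rw [show j = 1 by omega, inner_one]
    exact Finset.empty_subset _

/-- A vertex whose identifier exceeds the number of sites has an empty index range: its inner
constraint set is already everything. -/
lemma idxRange_eq_empty (h2 : 2 ≤ j) (hk : j ≤ k) (hs : (T.card : ℤ) < G.s j) :
    G.idxRange T m r i j = ∅ := by
  rw [idxRange, Finset.sdiff_eq_empty_iff_subset]
  refine (G.outer_subset T m r i (by omega) hk).trans ?_
  rw [G.inner_eq T m r i h2 hk, if_pos (by omega), nbhdS_eq_self T m r (by omega)]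
  exact Finset.subset_union_left

end Genogram

/-! ### Sub-genograms -/

namespace Genogram

lemma ext_of_forall {k : ℕ} {G H : Genogram k}
    (h : ∀ j ∈ Finset.Icc 1 k, G.p j = H.p j ∧ G.s j = H.s j) : G = H := by
  have hp : G.p = H.p := by
    funext j
    by_cases hj : j ∈ Finset.Icc 2 k
    · exact (h j (Finset.Icc_subset_Icc_left (by norm_num) hj)).1
    · rw [G.p_eq_zero j hj, H.p_eq_zero j hj]
  have hs : G.s = H.s := by
    funext j
    by_cases hj : j ∈ Finset.Icc 1 k
    · exact (h j hj).2
    · rw [G.s_eq_zero j hj, H.s_eq_zero j hj]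
  cases G; cases H; simp_all

section Sub

variable {l n : ℕ} {G : Genogram l} {H : Genogram n}

lemma IsSub.p_eq (h : G.IsSub H) {j : ℕ} (hj : j ≤ l) : H.p j = G.p j := by
  rcases Nat.eq_zero_or_pos j with rfl | h0
  · rw [G.p_zero, H.p_zero]
  · exact (h.2 j (Finset.mem_Icc.2 ⟨h0, hj⟩)).1

lemma IsSub.s_eq (h : G.IsSub H) {j : ℕ} (hj : j ≤ l) : H.s j = G.s j := by
  rcases Nat.eq_zero_or_pos j with rfl | h0
  · rw [G.s_eq_zero 0 (by simp), H.s_eq_zero 0 (by simp)]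
  · exact (h.2 j (Finset.mem_Icc.2 ⟨h0, hj⟩)).2

lemma IsSub.refl (G : Genogram l) : G.IsSub G := ⟨le_rfl, fun _ _ => ⟨rfl, rfl⟩⟩

lemma IsSub.trans {t : ℕ} {K : Genogram t} (h : G.IsSub H) (h' : H.IsSub K) : G.IsSub K :=
  ⟨h.1.trans h'.1, fun j hj => by
    have hj' := (Finset.mem_Icc.1 hj).2
    rw [h'.p_eq (hj'.trans h.1), h'.s_eq (hj'.trans h.1), h.p_eq hj', h.s_eq hj']
    exact ⟨rfl, rfl⟩⟩

lemma IsSub.eq {G H : Genogram l} (h : G.IsSub H) : H = G :=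
  ext_of_forall fun j hj => h.2 j hj

lemma IsSub.A_eq (h : G.IsSub H) {j : ℕ} (hj : j ≤ l) : H.A j = G.A j := by
  induction j using Nat.strong_induction_on with
  | _ j ih =>
  have hp := h.p_eq hj
  by_cases h0 : G.p j = 0
  · rw [G.A_eq_empty h0, H.A_eq_empty (hp.trans h0)]
  · have hpos : 0 < j := by
      rcases Nat.eq_zero_or_pos j with rfl | h'
      · exact absurd G.p_zero h0
      · exact h'
    have := G.p_lt hpos
    rw [Genogram.A_eq G h0, Genogram.A_eq H (by rwa [hp]), hp, ih _ this (by omega)]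

lemma IsSub.u_eq (h : G.IsSub H) {j : ℕ} (hj : j ≤ l) : H.u j = G.u j := by
  rw [u, u, h.A_eq hj]
  congr 1
  refine Finset.filter_congr fun x hx => ?_
  have hx' : x ≤ l := by
    rcases Finset.mem_insert.1 hx with rfl | hx
    · exact hj
    · exact (G.lt_of_mem_A hx).le.trans hj
  rw [h.s_eq hx']

variable {d : ℕ} (T : Finset (Fin d → ℤ)) (m : ℕ) (r : (Fin d → ℤ) → (Fin d → ℤ) → Prop)
  (i : ℕ → Fin d → ℤ)

lemma IsSub.inner_eq (h : G.IsSub H) {j : ℕ} (h1 : 1 ≤ j) (hj : j ≤ l) :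
    H.inner T m r i j = G.inner T m r i j := by
  induction j using Nat.strong_induction_on with
  | _ j ih =>
  rcases Nat.lt_or_ge 1 j with h2 | h2
  · have hp := G.p_pos h2 hj
    have hlt := G.p_lt' h2
    rw [Genogram.inner_eq G T m r i h2 hj, Genogram.inner_eq H T m r i h2 (hj.trans h.1), h.A_eq hj,
      h.s_eq hj, h.p_eq hj, ih _ hlt hp (hlt.le.trans hj)]
  · rw [show j = 1 by omega, inner_one, inner_one]

lemma IsSub.outer_eq (h : G.IsSub H) {j : ℕ} (h1 : 1 ≤ j) (hj : j ≤ l) :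
    H.outer T m r i j = G.outer T m r i j := by
  induction j using Nat.strong_induction_on with
  | _ j ih =>
  rcases Nat.lt_or_ge 1 j with h2 | h2
  · have hp := G.p_pos h2 hj
    have hlt := G.p_lt' h2
    have hs := h.s_eq hj
    rcases lt_or_ge (G.s j) 0 with h0 | h0
    · rw [G.outer_of_neg T m r i h2 hj h0,
        H.outer_of_neg T m r i h2 (hj.trans h.1) (by rwa [hs]), h.p_eq hj,
        ih _ hlt hp (hlt.le.trans hj)]
    · rw [G.outer_of_nonneg T m r i h2 hj h0,
        H.outer_of_nonneg T m r i h2 (hj.trans h.1) (by rwa [hs]), h.p_eq hj, hs, h.A_eq hj,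
        h.inner_eq T m r i hp (hlt.le.trans hj)]
  · rw [show j = 1 by omega, outer_one, outer_one]

lemma IsSub.idxRange_eq (h : G.IsSub H) {j : ℕ} (h1 : 1 ≤ j) (hj : j ≤ l) :
    H.idxRange T m r i j = G.idxRange T m r i j := by
  rw [idxRange, idxRange, h.outer_eq T m r i h1 hj, h.inner_eq T m r i h1 hj]

lemma IsSub.admissible_iff (h : G.IsSub H) {t : ℕ} (ht : t ≤ l) :
    H.Admissible T m r t i ↔ G.Admissible T m r t i := by
  refine forall₂_congr fun j hj => ?_
  rw [Finset.mem_Icc] at hj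
  rw [h.idxRange_eq T m r i hj.1 (hj.2.trans ht)]

end Sub

/-- The genogram induced by `H` on its first `l` vertices. -/
def take {n : ℕ} (H : Genogram n) (l : ℕ) (h1 : 1 ≤ l) (hl : l ≤ n) : Genogram l where
  p j := if j ≤ l then H.p j else 0
  s j := if j ≤ l then H.s j else 0
  one_le_order := h1
  p_eq_zero j hj := by
    split_ifs with h
    · exact H.p_eq_zero j fun h' => hj (by rw [Finset.mem_Icc] at *; omega)
    · rfl
  s_eq_zero j hj := by
    split_ifs with h
    · exact H.s_eq_zero j fun h' => hj (by rw [Finset.mem_Icc] at *; omega)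
    · rfl
  p_mem j hj := by
    rw [Finset.mem_Icc] at hj
    rw [if_pos hj.2]
    exact H.p_mem j (Finset.mem_Icc.2 ⟨hj.1, hj.2.trans hl⟩)
  s_root := by rw [if_pos h1, H.s_root]
  neg_one_le_s j hj := by
    rw [Finset.mem_Icc] at hj
    rw [if_pos hj.2]
    exact H.neg_one_le_s j (Finset.mem_Icc.2 ⟨hj.1, hj.2.trans hl⟩)
  s_child_root j hj := by
    rw [Finset.mem_Icc] at hj
    rw [if_pos hj.2, if_pos hj.2]
    exact H.s_child_root j (Finset.mem_Icc.2 ⟨hj.1, hj.2.trans hl⟩)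
  s_sibling j hj h hh := by
    rw [Finset.mem_Icc] at hj hh
    rw [if_pos hj.2, if_pos hj.2, if_pos hh.2, if_pos hh.2]
    exact H.s_sibling j (Finset.mem_Icc.2 ⟨hj.1, hj.2.trans hl⟩) h
      (Finset.mem_Icc.2 ⟨hh.1, hh.2.trans hl⟩)
  depth_first j hj hjl t ht := by
    rw [Finset.mem_Icc] at ht
    rw [if_pos ht.2, if_pos hjl]
    exact H.depth_first j hj (hjl.trans hl) t (Finset.mem_Icc.2 ⟨ht.1, ht.2.trans hl⟩)
  label_sibling j hj h hh := by
    rw [Finset.mem_Icc] at hj hh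
    rw [if_pos hj.2, if_pos hj.2, if_pos hh.2, if_pos hh.2]
    exact H.label_sibling j (Finset.mem_Icc.2 ⟨hj.1, hj.2.trans hl⟩) h
      (Finset.mem_Icc.2 ⟨hh.1, hh.2.trans hl⟩)

lemma take_isSub {n : ℕ} (H : Genogram n) (l : ℕ) (h1 : 1 ≤ l) (hl : l ≤ n) :
    (H.take l h1 hl).IsSub H := by
  refine ⟨hl, fun j hj => ?_⟩
  simp [take, (Finset.mem_Icc.1 hj).2]

lemma IsSub.take {l n t : ℕ} {G : Genogram l} {H : Genogram n} (h : G.IsSub H) (hlt : l ≤ t)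
    (h1 : 1 ≤ t) (ht : t ≤ n) : G.IsSub (H.take t h1 ht) := by
  refine ⟨hlt, fun j hj => ?_⟩
  simpa [Genogram.take, (Finset.mem_Icc.1 hj).2.trans hlt] using h.2 j hj

lemma IsSub.take_eq {l n : ℕ} {G : Genogram l} {H : Genogram n} (h : G.IsSub H) :
    H.take l G.one_le_order h.1 = G :=
  (h.take le_rfl G.one_le_order h.1).eq

/-! ### Adding one vertex to a genogram -/

section Add

variable {l : ℕ} (G : Genogram l)

/-- In depth-first order, the vertices labelled between an ancestor `v[c]` and `v[j]` are
descendants of `v[c]`. -/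
lemma le_p_of_mem_A {j c t : ℕ} (hj : j ≤ l) (hc : c ∈ G.A j) (hct : c < t) (htj : t ≤ j) :
    c ≤ G.p t := by
  induction j using Nat.strong_induction_on with
  | _ j ih =>
  have h2 : 2 ≤ j := by
    by_contra h
    have : G.A j = ∅ := G.A_eq_empty (G.p_eq_zero j (by rw [Finset.mem_Icc]; omega))
    rw [this] at hc
    simp at hc
  have hlt := G.p_lt' h2
  have key : ∀ t, G.p j < t → t ≤ j → G.p j ≤ G.p t := by
    intro t h3 h4
    obtain ⟨t, rfl⟩ := Nat.exists_eq_succ_of_ne_zero (show t ≠ 0 by omega)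
    refine G.depth_first t ?_ (by omega) j (Finset.mem_Icc.2 ⟨by omega, hj⟩) (by omega)
    have := G.p_pos h2 hj
    omega
  rw [G.A_eq' h2 hj, Finset.mem_insert] at hc
  rcases hc with rfl | hc
  · exact key t hct htj
  · rcases le_or_gt t (G.p j) with h | h
    · exact ih _ hlt (hlt.le.trans hj) hc h
    · exact (G.lt_of_mem_A hc).le.trans (key t h htj)

lemma mem_A_of_forall_le {q j : ℕ} (hq : 1 ≤ q) (hj : j ≤ l) (hqj : q < j)
    (h : ∀ t, q < t → t ≤ j → q ≤ G.p t) : q ∈ G.A j := by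
  induction j using Nat.strong_induction_on with
  | _ j ih =>
  have h2 : 2 ≤ j := by omega
  rw [G.A_eq' h2 hj, Finset.mem_insert]
  rcases (h j hqj le_rfl).eq_or_lt with h' | h'
  · exact Or.inl h'
  · have hlt := G.p_lt' h2
    exact Or.inr (ih _ hlt (by omega) h' fun t h3 h4 => h t h3 (by omega))

/-- The labels `≥ 2` on the path from the root to `v[j]`. -/
def path (j : ℕ) : Finset ℕ := (insert j (G.A j)).filter (2 ≤ ·)

lemma path_one : G.path 1 = ∅ := by
  rw [path, A_one]; rfl

lemma path_eq {j : ℕ} (h2 : 2 ≤ j) (hj : j ≤ l) : G.path j = insert j (G.path (G.p j)) := by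
  rw [path, Finset.filter_insert, if_pos h2, G.A_eq' h2 hj, path]

lemma mem_path {j c : ℕ} : c ∈ G.path j ↔ (c = j ∨ c ∈ G.A j) ∧ 2 ≤ c := by
  simp [path]

lemma le_of_mem_path {j c : ℕ} (hc : c ∈ G.path j) : c ≤ j := by
  rcases (G.mem_path.1 hc).1 with rfl | h
  · exact le_rfl
  · exact (G.lt_of_mem_A h).le

lemma notMem_path_p {j : ℕ} (h2 : 2 ≤ j) : j ∉ G.path (G.p j) := fun h =>
  absurd (G.le_of_mem_path h) (by have := G.p_lt' h2; omega)

lemma A_subset_of_mem_A {j c : ℕ} (hc : c ∈ G.A j) : G.A c ⊆ G.A j := by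
  intro x hx
  rw [mem_A] at hc hx ⊢
  obtain ⟨-, t, ht, rfl⟩ := hc
  obtain ⟨h0, t', ht', rfl⟩ := hx
  exact ⟨h0, t' + t, by omega, by rw [Function.iterate_add_apply]⟩

lemma p_mem_A_of_mem_path {j c : ℕ} (hj : j ≤ l) (hc : c ∈ G.path j) : G.p c ∈ G.A j := by
  have h2 := (G.mem_path.1 hc).2
  have hcl := (G.le_of_mem_path hc).trans hj
  have : G.p c ∈ G.A c := by rw [G.A_eq' h2 hcl]; exact Finset.mem_insert_self _ _
  rcases (G.mem_path.1 hc).1 with rfl | h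
  · exact this
  · exact G.A_subset_of_mem_A h this

lemma exists_mem_path_of_mem_A {j q : ℕ} (hj : j ≤ l) (hq : q ∈ G.A j) :
    ∃ c ∈ G.path j, G.p c = q := by
  induction j using Nat.strong_induction_on with
  | _ j ih =>
  have h2 : 2 ≤ j := by
    by_contra h
    have : G.A j = ∅ := G.A_eq_empty (G.p_eq_zero j (by rw [Finset.mem_Icc]; omega))
    rw [this] at hq
    simp at hq
  have hlt := G.p_lt' h2
  rw [G.path_eq h2 hj]
  rw [G.A_eq' h2 hj, Finset.mem_insert] at hq
  rcases hq with rfl | hq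
  · exact ⟨j, Finset.mem_insert_self _ _, rfl⟩
  · obtain ⟨c, hc, h⟩ := ih _ hlt (by omega) hq
    exact ⟨c, Finset.mem_insert_of_mem hc, h⟩

/-- A vertex on the path to `v[j]` is, among its siblings, the one with the largest label `≤ j`. -/
lemma le_of_p_eq {j c t : ℕ} (hj : j ≤ l) (hc : c ∈ G.path j) (htj : t ≤ j)
    (h : G.p t = G.p c) : t ≤ c := by
  by_contra hct
  have h2 := (G.mem_path.1 hc).2
  have hcA : c ∈ G.A j := by
    rcases (G.mem_path.1 hc).1 with rfl | h
    · omega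
    · exact h
  have := G.le_p_of_mem_A hj hcA (by omega) htj
  have := G.p_lt' h2
  omega

lemma p_injOn_path {j : ℕ} (hj : j ≤ l) : Set.InjOn G.p (G.path j : Set ℕ) := by
  intro c hc c' hc' h
  exact le_antisymm (G.le_of_p_eq hj hc' (G.le_of_mem_path hc) h)
    (G.le_of_p_eq hj hc (G.le_of_mem_path hc') h.symm)

/-- The conditions under which a vertex with parent `v[q]` and identifier `s` can be appended to
`G` as the vertex with the largest label. -/
structure CanAdd (q : ℕ) (s : ℤ) : Prop where
  one_le : 1 ≤ q
  le_order : q ≤ l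
  le_p : ∀ t, q < t → t ≤ l → q ≤ G.p t
  neg_one_le : -1 ≤ s
  root : q = 1 → 0 ≤ s
  sibling : ∀ j ∈ Finset.Icc 2 l, G.p j = q → 0 ≤ s ∧ s < G.s j

variable {G} in
/-- The genogram obtained by appending a vertex with parent `v[q]` and identifier `s`. -/
def add {q : ℕ} {s : ℤ} (h : G.CanAdd q s) : Genogram (l + 1) where
  p j := if j = l + 1 then q else G.p j
  s j := if j = l + 1 then s else G.s j
  one_le_order := by omega
  p_eq_zero j hj := by
    rw [Finset.mem_Icc] at hj
    have := G.one_le_order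
    rw [if_neg (by omega)]
    exact G.p_eq_zero j (by rw [Finset.mem_Icc]; omega)
  s_eq_zero j hj := by
    rw [Finset.mem_Icc] at hj
    rw [if_neg (by omega)]
    exact G.s_eq_zero j (by rw [Finset.mem_Icc]; omega)
  p_mem j hj := by
    rw [Finset.mem_Icc] at hj
    have := h.one_le
    have := h.le_order
    split_ifs with h'
    · omega
    · exact G.p_mem j (by rw [Finset.mem_Icc]; omega)
  s_root := by
    have := G.one_le_order
    rw [if_neg (by omega), G.s_root]
  neg_one_le_s j hj := by
    rw [Finset.mem_Icc] at hj
    split_ifs with h'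
    · exact h.neg_one_le
    · exact G.neg_one_le_s j (by rw [Finset.mem_Icc]; omega)
  s_child_root j hj := by
    rw [Finset.mem_Icc] at hj
    split_ifs with h'
    · exact h.root
    · exact G.s_child_root j (by rw [Finset.mem_Icc]; omega)
  s_sibling j hj t ht hjt := by
    rw [Finset.mem_Icc] at hj ht
    split_ifs with h1 h2 h2
    · omega
    · intro h3
      have := h.sibling t (by rw [Finset.mem_Icc]; omega) h3.symm
      omega
    · intro h3
      have := h.sibling j (by rw [Finset.mem_Icc]; omega) h3
      omega
    · exact G.s_sibling j (by rw [Finset.mem_Icc]; omega) t (by rw [Finset.mem_Icc]; omega) hjt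
  depth_first j hj hjl t ht := by
    rw [Finset.mem_Icc] at ht
    split_ifs with h1 h2 h2
    · exact fun _ => le_rfl
    · exact fun h3 => h.le_p (j + 1) (by omega) (by omega)
    · omega
    · exact G.depth_first j hj (by omega) t (by rw [Finset.mem_Icc]; omega)
  label_sibling j hj t ht hjt := by
    rw [Finset.mem_Icc] at hj ht
    split_ifs with h1 h2 h2
    · omega
    · intro h3
      have := h.sibling t (by rw [Finset.mem_Icc]; omega) h3.symm
      omega
    · intro h3
      have := h.sibling j (by rw [Finset.mem_Icc]; omega) h3
      omega
    · exact G.label_sibling j (by rw [Finset.mem_Icc]; omega) t (by rw [Finset.mem_Icc]; omega) hjt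

variable {G}

lemma isSub_add {q : ℕ} {s : ℤ} (h : G.CanAdd q s) : G.IsSub (add h) := by
  refine ⟨by omega, fun j hj => ?_⟩
  rw [Finset.mem_Icc] at hj
  simp [add, show j ≠ l + 1 by omega]

lemma add_p {q : ℕ} {s : ℤ} (h : G.CanAdd q s) : (add h).p (l + 1) = q := by simp [add]

lemma add_s {q : ℕ} {s : ℤ} (h : G.CanAdd q s) : (add h).s (l + 1) = s := by simp [add]

lemma IsSub.ext {H H' : Genogram (l + 1)} (h : G.IsSub H) (h' : G.IsSub H')
    (hp : H.p (l + 1) = H'.p (l + 1)) (hs : H.s (l + 1) = H'.s (l + 1)) : H = H' := by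
  refine ext_of_forall fun j hj => ?_
  rw [Finset.mem_Icc] at hj
  rcases hj.2.eq_or_lt with rfl | hlt
  · exact ⟨hp, hs⟩
  · have hjl : j ≤ l := by omega
    rw [h.p_eq hjl, h'.p_eq hjl, h.s_eq hjl, h'.s_eq hjl]
    exact ⟨rfl, rfl⟩

lemma canAdd_child {s : ℤ} (hs : 0 ≤ s) : G.CanAdd l s where
  one_le := G.one_le_order
  le_order := le_rfl
  le_p t h1 h2 := by omega
  neg_one_le := by omega
  root _ := hs
  sibling j hj h := by
    rw [Finset.mem_Icc] at hj
    have := G.p_lt' hj.1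
    omega

lemma canAdd_neg (h2 : 2 ≤ l) : G.CanAdd l (-1) where
  one_le := G.one_le_order
  le_order := le_rfl
  le_p t h1 h2 := by omega
  neg_one_le := le_rfl
  root h := by omega
  sibling j hj h := by
    rw [Finset.mem_Icc] at hj
    have := G.p_lt' hj.1
    omega

lemma canAdd_sibling {c : ℕ} {s : ℤ} (hc : c ∈ G.path l) (hs : 0 ≤ s) (hsc : s < G.s c) :
    G.CanAdd (G.p c) s where
  one_le := G.p_pos (G.mem_path.1 hc).2 (G.le_of_mem_path hc)
  le_order := (G.p_lt' (G.mem_path.1 hc).2).le.trans (G.le_of_mem_path hc)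
  le_p t h1 h2 := G.le_p_of_mem_A le_rfl (G.p_mem_A_of_mem_path le_rfl hc) h1 h2
  neg_one_le := by omega
  root _ := hs
  sibling j hj h := by
    refine ⟨hs, ?_⟩
    have h2 := (G.mem_path.1 hc).2
    have hcl := G.le_of_mem_path hc
    have hjc := G.le_of_p_eq le_rfl hc (Finset.mem_Icc.1 hj).2 h
    rcases hjc.eq_or_lt with rfl | hlt
    · exact hsc
    · exact hsc.trans ((G.label_sibling j hj c (Finset.mem_Icc.2 ⟨h2, hcl⟩) hlt.ne h).2 hlt)

/-- The parent of a last vertex lies on the path to the vertex before it; if it is not that vertex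
itself, then the identifier of the last vertex is smaller than that of the sibling on the path. -/
lemma IsSub.exists_path {H : Genogram (l + 1)} (h : G.IsSub H) (hp : H.p (l + 1) ≠ l) :
    ∃ c ∈ G.path l, G.p c = H.p (l + 1) ∧ 0 ≤ H.s (l + 1) ∧ H.s (l + 1) < G.s c := by
  have h1 := G.one_le_order
  have hpos := H.p_pos (j := l + 1) (by omega) le_rfl
  have hlt := H.p_lt' (j := l + 1) (by omega)
  have hA : H.p (l + 1) ∈ G.A l := by
    refine G.mem_A_of_forall_le hpos le_rfl (by omega) fun t ht htl => ?_
    rw [← h.p_eq htl]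
    obtain ⟨t, rfl⟩ := Nat.exists_eq_succ_of_ne_zero (show t ≠ 0 by omega)
    exact H.depth_first t (by omega) (by omega) (l + 1) (Finset.mem_Icc.2 ⟨by omega, le_rfl⟩)
      (by omega)
  obtain ⟨c, hc, hpc⟩ := G.exists_mem_path_of_mem_A le_rfl hA
  have h2 := (G.mem_path.1 hc).2
  have hcl := G.le_of_mem_path hc
  have hpe : H.p c = H.p (l + 1) := by rw [h.p_eq hcl, hpc]
  have hc' : c ∈ Finset.Icc 2 (l + 1) := Finset.mem_Icc.2 ⟨h2, by omega⟩
  have hl' : l + 1 ∈ Finset.Icc 2 (l + 1) := Finset.mem_Icc.2 ⟨by omega, le_rfl⟩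
  refine ⟨c, hc, hpc, (H.s_sibling c hc' _ hl' (by omega) hpe).2.1, ?_⟩
  rw [← h.s_eq hcl]
  exact (H.label_sibling c hc' _ hl' (by omega) hpe).2 (by omega)

lemma IsSub.of_neg {H : Genogram (l + 1)} (h : G.IsSub H) (hs : H.s (l + 1) < 0) :
    H.p (l + 1) = l ∧ H.s (l + 1) = -1 ∧ 2 ≤ l := by
  have h1 := G.one_le_order
  have hl' : l + 1 ∈ Finset.Icc 2 (l + 1) := Finset.mem_Icc.2 ⟨by omega, le_rfl⟩
  have hp : H.p (l + 1) = l := by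
    by_contra hp
    obtain ⟨c, -, -, h0, -⟩ := h.exists_path hp
    omega
  refine ⟨hp, ?_, ?_⟩
  · have := H.neg_one_le_s _ hl'
    omega
  · by_contra h2
    have := H.s_child_root _ hl' (by omega)
    omega

/-! ### Leaves, negative vertices and coefficients after adding one vertex -/

lemma IsSub.negatives_eq {H : Genogram (l + 1)} (h : G.IsSub H) :
    H.negatives = G.negatives + if H.s (l + 1) = -1 then 1 else 0 := by
  rw [negatives, negatives, ← Finset.insert_Icc_right_eq_Icc_add_one (by omega),
    Finset.filter_insert]
  have : (Finset.Icc 1 l).filter (fun j => H.s j = -1) =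
      (Finset.Icc 1 l).filter (fun j => G.s j = -1) :=
    Finset.filter_congr fun j hj => by rw [h.s_eq (Finset.mem_Icc.1 hj).2]
  split_ifs
  · rw [Finset.card_insert_of_notMem (by simp), this]
  · rw [this, add_zero]

lemma IsSub.leaves_eq {H : Genogram (l + 1)} (h : G.IsSub H) :
    H.leaves = G.leaves + if H.p (l + 1) = l then 0 else 1 := by
  have h1 := G.one_le_order
  have himg : (Finset.Icc 1 l).image H.p = (Finset.Icc 1 l).image G.p :=
    Finset.image_congr fun j hj => h.p_eq (by simpa using (Finset.mem_Icc.1 hj).2)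
  have hlt : ∀ j ∈ (Finset.Icc 1 l).image G.p, j < l := by
    intro j hj
    obtain ⟨t, ht, rfl⟩ := Finset.mem_image.1 hj
    rw [Finset.mem_Icc] at ht
    exact (G.p_lt (by omega)).trans_le ht.2
  have hplt := H.p_lt' (j := l + 1) (by omega)
  have hmem : l + 1 ∉ insert (H.p (l + 1)) ((Finset.Icc 1 l).image G.p) := by
    rw [Finset.mem_insert]
    rintro (h' | h')
    · omega
    · have := hlt _ h'
      omega
  rw [leaves, leaves, ← Finset.insert_Icc_right_eq_Icc_add_one (by omega), Finset.image_insert,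
    himg, Finset.filter_insert, if_pos hmem, Finset.card_insert_of_notMem (by simp)]
  split_ifs with hp
  · -- `v[l]` is a leaf of `G` that is replaced by the new leaf
    have hl : l ∈ (Finset.Icc 1 l).filter (fun j => j ∉ (Finset.Icc 1 l).image G.p) := by
      rw [Finset.mem_filter, Finset.mem_Icc]
      exact ⟨⟨h1, le_rfl⟩, fun h' => absurd (hlt _ h') (lt_irrefl _)⟩
    rw [add_zero, ← Finset.card_erase_add_one hl]
    congr 2
    ext j
    simp only [hp, Finset.mem_filter, Finset.mem_insert, Finset.mem_erase, not_or]
    tauto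
  · obtain ⟨c, hc, hpc, -⟩ := h.exists_path hp
    have hc2 := (G.mem_path.1 hc).2
    have : H.p (l + 1) ∈ (Finset.Icc 1 l).image G.p :=
      Finset.mem_image.2 ⟨c, Finset.mem_Icc.2 ⟨by omega, G.le_of_mem_path hc⟩, hpc⟩
    rw [Finset.insert_eq_of_mem this]

lemma coeffB_of_nonneg {t : ℕ} {G : Genogram t} {H : Genogram l} {K : Genogram (l + 1)}
    (hK : H.IsSub K) (hs : 0 ≤ K.s (l + 1)) :
    K.coeffB G = (if K.p (l + 1) = l then -1 else 1) * H.coeffA G := by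
  have hu : ∀ j ∈ Finset.Icc (t + 1) l, 1 / ((j : ℝ) + 1 - K.u j) = 1 / ((j : ℝ) + 1 - H.u j) :=
    fun j hj => by rw [hK.u_eq (Finset.mem_Icc.1 hj).2]
  rw [coeffB, coeffA, hK.leaves_eq, hK.negatives_eq, if_neg (show K.s (l + 1) ≠ -1 by omega),
    Nat.add_sub_cancel, Finset.prod_congr rfl hu]
  split_ifs with hp
  · rw [zpow_add_one₀ (by norm_num)]
    push_cast
    simp only [add_zero]
    ring
  · rw [show ((H.leaves + 1 : ℕ) : ℤ) - G.leaves + (H.negatives + 0 : ℕ) - G.negatives + 1 =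
      (H.leaves : ℤ) - G.leaves + H.negatives - G.negatives + 1 + 1 by push_cast; ring,
      zpow_add_one₀ (by norm_num), zpow_add_one₀ (by norm_num)]
    ring

lemma coeffB_of_neg {t : ℕ} {G : Genogram t} {H : Genogram l} {K : Genogram (l + 1)}
    (hK : H.IsSub K) (hs : K.s (l + 1) < 0) : K.coeffB G = H.coeffA G := by
  have hu : ∀ j ∈ Finset.Icc (t + 1) l, 1 / ((j : ℝ) + 1 - K.u j) = 1 / ((j : ℝ) + 1 - H.u j) :=
    fun j hj => by rw [hK.u_eq (Finset.mem_Icc.1 hj).2]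
  rw [coeffB, coeffA, hK.leaves_eq, hK.negatives_eq, if_pos (hK.of_neg hs).2.1,
    if_pos (hK.of_neg hs).1, Nat.add_sub_cancel, Finset.prod_congr rfl hu,
    show ((H.leaves + 0 : ℕ) : ℤ) - G.leaves + (H.negatives + 1 : ℕ) - G.negatives + 1 =
      (H.leaves : ℤ) - G.leaves + H.negatives - G.negatives + 1 + 1 by push_cast; ring,
      zpow_add_one₀ (by norm_num), zpow_add_one₀ (by norm_num)]
  ring

lemma coeffA_self (G : Genogram l) : G.coeffA G = 1 := by
  rw [coeffA, Finset.Icc_eq_empty (by omega)]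
  simp

lemma coeffA_eq {t : ℕ} {G : Genogram t} {H : Genogram (l + 1)} (ht : t ≤ l) :
    H.coeffA G = -(1 / ((l : ℝ) + 1 + 1 - H.u (l + 1))) * H.coeffB G := by
  rw [coeffA, coeffB, Nat.add_sub_cancel, ← Finset.insert_Icc_right_eq_Icc_add_one (by omega),
    Finset.prod_insert (by simp), zpow_add_one₀ (by norm_num)]
  push_cast
  ring

end Add

end Genogram

/-! ### Generalized covariances as functions of their last argument -/

section Covariance

variable {Ω : Type*} [MeasurableSpace Ω] {μ : Measure Ω}

lemma DstarDefined.of_infix {L L' : List (Ω → ℝ)} (h : DstarDefined μ L) (h' : L' <:+: L) :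
    DstarDefined μ L' := fun L'' h'' => h L'' (h''.trans h')

/-- If `𝒟*(Y₁, …, Yₜ)` is well-defined then `Y₁ ⋯ Yⱼ 𝒟(Yⱼ₊₁, …, Yₜ)` is integrable. -/
lemma DstarDefined.integrable_prod_mul_calD {L₁ L₂ : List (Ω → ℝ)}
    (h : DstarDefined μ (L₁ ++ L₂)) :
    Integrable (fun ω => (L₁.map fun Y => Y ω).prod * calD μ L₂ ω) μ := by
  induction L₂ generalizing L₁ with
  | nil => simpa [calD] using h L₁ (by simp)
  | cons Y L ih =>
    have h1 := ih (L₁ := L₁ ++ [Y]) (by simpa using h)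
    have h2 := (h L₁ (List.prefix_append _ _).isInfix).mul_const (∫ ω', Y ω' * calD μ L ω' ∂μ)
    refine (h1.sub h2).congr (Filter.Eventually.of_forall fun ω => ?_)
    simp only [Pi.sub_apply, List.map_append, List.map_cons, List.map_nil, List.prod_append,
      List.prod_cons, List.prod_nil, calD]
    ring

lemma DstarDefined.integrable_mul_calD {Y : Ω → ℝ} {L : List (Ω → ℝ)}
    (h : DstarDefined μ (Y :: L)) : Integrable (fun ω => Y ω * calD μ L ω) μ := by
  simpa using DstarDefined.integrable_prod_mul_calD (L₁ := [Y]) (L₂ := L) h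

lemma calD_concat_sum {ι : Type*} (S : Finset ι) (c : ι → ℝ) (Z : ι → Ω → ℝ)
    (L : List (Ω → ℝ)) (h : ∀ x ∈ S, DstarDefined μ (L ++ [Z x])) (ω : Ω) :
    calD μ (L ++ [fun ω => ∑ x ∈ S, c x * Z x ω]) ω = ∑ x ∈ S, c x * calD μ (L ++ [Z x]) ω := by
  induction L generalizing ω with
  | nil =>
    have hi : ∀ x ∈ S, Integrable (fun ω => c x * Z x ω) μ := fun x hx => by
      simpa using ((h x hx [Z x] (by simp)).const_mul (c x))
    simp only [List.nil_append, calD, mul_one]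
    rw [integral_finsetSum _ hi, ← Finset.sum_sub_distrib]
    refine Finset.sum_congr rfl fun x _ => ?_
    rw [integral_const_mul]
    ring
  | cons Y L ih =>
    have ih := ih fun x hx => (h x hx).of_infix (List.infix_cons List.infix_rfl)
    have hi : ∀ x ∈ S, Integrable (fun ω => c x * (Y ω * calD μ (L ++ [Z x]) ω)) μ :=
      fun x hx => (h x hx).integrable_mul_calD.const_mul _
    have he : ∀ ω, Y ω * calD μ (L ++ [fun ω => ∑ x ∈ S, c x * Z x ω]) ω =
        ∑ x ∈ S, c x * (Y ω * calD μ (L ++ [Z x]) ω) := fun ω => by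
      rw [ih, Finset.mul_sum]
      exact Finset.sum_congr rfl fun x _ => by ring
    simp only [List.cons_append, calD]
    simp_rw [he]
    rw [integral_finsetSum _ hi, ← Finset.sum_sub_distrib]
    refine Finset.sum_congr rfl fun x _ => ?_
    rw [integral_const_mul]
    ring

lemma calDstar_concat_sum {ι : Type*} (S : Finset ι) (c : ι → ℝ) (Z : ι → Ω → ℝ)
    (L : List (Ω → ℝ)) (h : ∀ x ∈ S, DstarDefined μ (L ++ [Z x])) :
    calDstar μ (L ++ [fun ω => ∑ x ∈ S, c x * Z x ω]) =
      ∑ x ∈ S, c x * calDstar μ (L ++ [Z x]) := by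
  cases L with
  | nil =>
    have hi : ∀ x ∈ S, Integrable (fun ω => c x * Z x ω) μ := fun x hx => by
      simpa using ((h x hx [Z x] (by simp)).const_mul (c x))
    simp only [List.nil_append, calDstar, calD, mul_one]
    rw [integral_finsetSum _ hi]
    exact Finset.sum_congr rfl fun x _ => integral_const_mul _ _
  | cons Y L =>
    have h' : ∀ x ∈ S, DstarDefined μ (L ++ [Z x]) := fun x hx =>
      (h x hx).of_infix (List.infix_cons List.infix_rfl)
    have hi : ∀ x ∈ S, Integrable (fun ω => c x * (Y ω * calD μ (L ++ [Z x]) ω)) μ :=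
      fun x hx => (h x hx).integrable_mul_calD.const_mul _
    have he : ∀ ω, Y ω * calD μ (L ++ [fun ω => ∑ x ∈ S, c x * Z x ω]) ω =
        ∑ x ∈ S, c x * (Y ω * calD μ (L ++ [Z x]) ω) := fun ω => by
      rw [calD_concat_sum S c Z L h' ω, Finset.mul_sum]
      exact Finset.sum_congr rfl fun x _ => by ring
    simp only [List.cons_append, calDstar]
    simp_rw [he]
    rw [integral_finsetSum _ hi]
    exact Finset.sum_congr rfl fun x _ => integral_const_mul _ _

lemma calD_append_congr (L : List (Ω → ℝ)) {L₁ L₂ : List (Ω → ℝ)} (h : calD μ L₁ = calD μ L₂) :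
    calD μ (L ++ L₁) = calD μ (L ++ L₂) := by
  induction L with
  | nil => exact h
  | cons Y L ih => simp only [List.cons_append, calD, ih]

lemma calDstar_append_congr (L : List (Ω → ℝ)) {L₁ L₂ : List (Ω → ℝ)}
    (h : calD μ L₁ = calD μ L₂) (h' : calDstar μ L₁ = calDstar μ L₂) :
    calDstar μ (L ++ L₁) = calDstar μ (L ++ L₂) := by
  cases L with
  | nil => exact h'
  | cons Y L => simp only [List.cons_append, calDstar, calD_append_congr L h]

/-- `𝒟*(…, Z, F) = 𝒟*(…, Z F) - 𝒟*(…, Z) E[F]`. -/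
lemma calDstar_concat_concat (L : List (Ω → ℝ)) (Z F : Ω → ℝ) (h : DstarDefined μ (L ++ [Z]))
    (h' : DstarDefined μ (L ++ [fun ω => Z ω * F ω])) :
    calDstar μ (L ++ [Z] ++ [F]) =
      calDstar μ (L ++ [fun ω => Z ω * F ω]) - calDstar μ (L ++ [Z]) * ∫ ω, F ω ∂μ := by
  have key := calDstar_concat_sum (μ := μ) (Finset.univ : Finset (Fin 2)) ![1, -∫ ω, F ω ∂μ]
    ![fun ω => Z ω * F ω, Z] L (by intro x _; fin_cases x <;> simpa)
  simp only [Fin.sum_univ_two, Matrix.cons_val_zero, Matrix.cons_val_one] at key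
  have he : ∀ ω, 1 * (Z ω * F ω) + (-∫ ω, F ω ∂μ) * Z ω = Z ω * (F ω - ∫ ω, F ω ∂μ) :=
    fun ω => by ring
  simp_rw [he] at key
  rw [List.append_assoc, calDstar_append_congr L (L₂ := [fun ω => Z ω * (F ω - ∫ ω, F ω ∂μ)]),
    key]
  · ring
  · funext ω; simp [calD]
  · simp [calDstar, calD]

/-- Merging the last two arguments preserves well-definedness. -/
lemma DstarDefined.merge_last {L : List (Ω → ℝ)} {Z F : Ω → ℝ}
    (h : DstarDefined μ (L ++ [Z] ++ [F])) : DstarDefined μ (L ++ [fun ω => Z ω * F ω]) := by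
  intro L' hL'
  rcases List.infix_concat_iff.1 hL' with hs | hi
  · rcases List.eq_nil_or_concat L' with rfl | ⟨M, Y, rfl⟩
    · exact h [] List.nil_infix
    · rw [List.concat_eq_append] at hs ⊢
      obtain ⟨M', hM'⟩ := hs
      rw [← List.append_assoc] at hM'
      obtain ⟨hM, hY⟩ := List.append_inj' hM' rfl
      obtain rfl : Y = fun ω => Z ω * F ω := by simpa using hY
      refine (h (M ++ [Z] ++ [F]) ?_).congr (Filter.Eventually.of_forall fun ω => ?_)
      · rw [← hM, List.append_assoc, List.append_assoc, List.append_assoc]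
        exact (List.suffix_append _ _).isInfix
      · simp
  · refine h L' (hi.trans ?_)
    rw [List.append_assoc]
    exact (List.prefix_append _ _).isInfix

lemma DstarDefined.integrable_last {L : List (Ω → ℝ)} {F : Ω → ℝ}
    (h : DstarDefined μ (L ++ [F])) : Integrable F μ := by
  simpa using h [F] (List.suffix_append _ _).isInfix

end Covariance

/-! ### The operator of a genogram as a function of its last argument -/

namespace Genogram

variable {Ω : Type*} [MeasurableSpace Ω] {μ : Measure Ω} {l : ℕ} (G : Genogram l)

lemma range'_eq_concat (hl : 1 ≤ l) : List.range' 1 l = List.range' 1 (l - 1) ++ [l] := by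
  obtain ⟨l, rfl⟩ := Nat.exists_eq_succ_of_ne_zero (show l ≠ 0 by omega)
  simp [List.range'_1_concat, add_comm]

/-- The decomposition of a genogram into branches, and of its last branch into blocks: the last
label is the last element of the last block of the last branch. -/
structure Decomp (pre : List (List ℕ)) (br : List ℕ) (bls : List (List ℕ)) (b : List ℕ) :
    Prop where
  branches : G.branches = pre ++ [br ++ [l]]
  blocks : G.blocks (br ++ [l]) = bls ++ [b ++ [l]]
  lt_of_mem_pre : ∀ m ∈ pre, ∀ x ∈ m, x < l
  lt_of_mem_br : ∀ x ∈ br, x < l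
  lt_of_mem_bls : ∀ m ∈ bls, ∀ x ∈ m, x < l
  lt_of_mem_b : ∀ x ∈ b, x < l

lemma exists_decomp : ∃ pre br bls b, G.Decomp pre br bls b := by
  have h1 := range'_eq_concat G.one_le_order
  obtain ⟨pre, br, hbr⟩ := List.exists_splitBy_concat (fun a b => decide (G.p b = a))
    (List.range' 1 (l - 1)) l
  obtain ⟨bls, b, hb⟩ := List.exists_splitBy_concat (fun _ b => decide (G.s b < 0)) br l
  have f1 := List.flatten_splitBy (fun a b => decide (G.p b = a)) (List.range' 1 (l - 1) ++ [l])
  rw [hbr] at f1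
  have f2 := List.flatten_splitBy (fun _ b => decide (G.s b < 0)) (br ++ [l])
  rw [hb] at f2
  have f1' : pre.flatten ++ br = List.range' 1 (l - 1) := by simpa [← List.append_assoc] using f1
  have f2' : bls.flatten ++ b = br := by simpa [← List.append_assoc] using f2
  have hlt : ∀ x ∈ pre.flatten ++ br, x < l := by
    intro x hx
    rw [f1', List.mem_range'_1] at hx
    omega
  have hlt' : ∀ x ∈ bls.flatten ++ b, x < l := by
    intro x hx
    rw [f2'] at hx
    exact hlt x (List.mem_append_right _ hx)
  refine ⟨pre, br, bls, b, ?_, hb, ?_, ?_, ?_, ?_⟩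
  · rw [Genogram.branches, h1, hbr]
  · exact fun m hm x hx => hlt x (List.mem_append_left _ (List.mem_flatten.2 ⟨m, hm, hx⟩))
  · exact fun x hx => hlt x (List.mem_append_right _ hx)
  · exact fun m hm x hx => hlt' x (List.mem_append_left _ (List.mem_flatten.2 ⟨m, hm, hx⟩))
  · exact fun x hx => hlt' x (List.mem_append_right _ hx)

variable {G}

lemma blockProducts_congr {Ω : Type*} {n : ℕ} {H : Genogram n} {Y Y' : ℕ → Ω → ℝ} {br : List ℕ}
    (hs : ∀ x ∈ br, H.s x = G.s x) (hY : ∀ x ∈ br, Y x = Y' x) :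
    H.blockProducts Y br = G.blockProducts Y' br := by
  have hb : H.blocks br = G.blocks br :=
    List.splitBy_congr fun a _ b hb => by rw [hs b hb]
  rw [blockProducts, blockProducts, hb]
  refine List.map_congr_left fun bl hbl => ?_
  funext ω
  congr 1
  exact List.map_congr_left fun x hx => by rw [hY x (List.mem_of_mem_splitBy hbl hx)]

/-- The arguments of the last factor `𝒟*` of `ℰ_G`, except for the last one. -/
def lastInit (bls : List (List ℕ)) (Y : ℕ → Ω → ℝ) : List (Ω → ℝ) :=
  bls.map fun bl ω => (bl.map fun t => Y t ω).prod

section Decomp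

variable {pre : List (List ℕ)} {br : List ℕ} {bls : List (List ℕ)} {b : List ℕ}

lemma lastInit_update {Ω : Type*} (hlt : ∀ m ∈ bls, ∀ x ∈ m, x < l) (Y : ℕ → Ω → ℝ) (Z : Ω → ℝ) :
    lastInit bls (Function.update Y l Z) = lastInit bls Y := by
  refine List.map_congr_left fun bl hbl => ?_
  funext ω
  congr 1
  refine List.map_congr_left fun x hx => ?_
  rw [Function.update_of_ne (hlt bl hbl x hx).ne]

lemma prod_update {Ω : Type*} (hlt : ∀ x ∈ b, x < l) (Y : ℕ → Ω → ℝ) (Z : Ω → ℝ) (ω : Ω) :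
    (b.map fun t => Function.update Y l Z t ω).prod = (b.map fun t => Y t ω).prod := by
  congr 1
  refine List.map_congr_left fun x hx => ?_
  rw [Function.update_of_ne (hlt x hx).ne]

lemma Decomp.blockProducts_last {Ω : Type*} (D : G.Decomp pre br bls b) (Y : ℕ → Ω → ℝ)
    (Z : Ω → ℝ) :
    G.blockProducts (Function.update Y l Z) (br ++ [l]) =
      lastInit bls Y ++ [fun ω => (b.map fun t => Y t ω).prod * Z ω] := by
  rw [blockProducts, D.blocks, List.map_append]
  congr 1
  · exact lastInit_update D.lt_of_mem_bls Y Z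
  · simp [prod_update D.lt_of_mem_b]

lemma Decomp.blockProducts_pre {Ω : Type*} (D : G.Decomp pre br bls b) {n : ℕ} {H : Genogram n}
    (h : G.IsSub H) (Y Y' : ℕ → Ω → ℝ) (hY : ∀ x < l, Y x = Y' x) :
    ∀ m ∈ pre, H.blockProducts Y m = G.blockProducts Y' m := fun m hm =>
  blockProducts_congr (fun x hx => h.s_eq (D.lt_of_mem_pre m hm x hx).le)
    fun x hx => hY x (D.lt_of_mem_pre m hm x hx)

lemma Decomp.calE_update (D : G.Decomp pre br bls b) (Y : ℕ → Ω → ℝ) (Z : Ω → ℝ) :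
    G.calE μ (Function.update Y l Z) =
      (pre.map fun m => calDstar μ (G.blockProducts Y m)).prod *
        calDstar μ (lastInit bls Y ++ [fun ω => (b.map fun t => Y t ω).prod * Z ω]) := by
  rw [calE, D.branches, List.map_append, List.prod_append, List.map_singleton,
    List.prod_singleton, D.blockProducts_last]
  congr 2
  refine List.map_congr_left fun m hm => ?_
  rw [D.blockProducts_pre (IsSub.refl G) _ Y fun x hx => Function.update_of_ne hx.ne _ _]
  exact hm

lemma Decomp.eDefined_update (D : G.Decomp pre br bls b) (Y : ℕ → Ω → ℝ) (Z : Ω → ℝ) :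
    G.EDefined μ (Function.update Y l Z) ↔
      (∀ m ∈ pre, DstarDefined μ (G.blockProducts Y m)) ∧
        DstarDefined μ (lastInit bls Y ++ [fun ω => (b.map fun t => Y t ω).prod * Z ω]) := by
  rw [EDefined, D.branches]
  simp only [List.mem_append, List.mem_singleton, or_imp, forall_and, forall_eq,
    D.blockProducts_last]
  refine and_congr_left' (forall₂_congr fun m hm => ?_)
  rw [D.blockProducts_pre (IsSub.refl G) _ Y fun x hx => Function.update_of_ne hx.ne _ _]
  exact hm

end Decomp

/-- `ℰ_G` is linear in its last argument. -/
lemma calE_update_sum {ι : Type*} (S : Finset ι) (c : ι → ℝ) (Z : ι → Ω → ℝ)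
    (Y : ℕ → Ω → ℝ) (h : ∀ x ∈ S, G.EDefined μ (Function.update Y l (Z x))) :
    G.calE μ (Function.update Y l fun ω => ∑ x ∈ S, c x * Z x ω) =
      ∑ x ∈ S, c x * G.calE μ (Function.update Y l (Z x)) := by
  obtain ⟨pre, br, bls, b, D⟩ := G.exists_decomp
  simp only [D.calE_update]
  have key := calDstar_concat_sum S c (fun x ω => (b.map fun t => Y t ω).prod * Z x ω)
    (lastInit bls Y) fun x hx => ((D.eDefined_update Y (Z x)).1 (h x hx)).2
  have he : ∀ ω, (b.map fun t => Y t ω).prod * ∑ x ∈ S, c x * Z x ω =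
      ∑ x ∈ S, c x * ((b.map fun t => Y t ω).prod * Z x ω) := fun ω => by
    rw [Finset.mul_sum]
    exact Finset.sum_congr rfl fun x _ => by ring
  simp_rw [he, key, Finset.mul_sum]
  exact Finset.sum_congr rfl fun x _ => by ring

section Ext

variable {H : Genogram (l + 1)}

lemma range'_succ_eq : List.range' 1 (l + 1) = List.range' 1 l ++ [l + 1] := by
  simp [List.range'_1_concat, add_comm]

lemma IsSub.splitBy_eq (h : G.IsSub H) :
    (List.range' 1 l).splitBy (fun a b => decide (H.p b = a)) = G.branches := by
  refine List.splitBy_congr fun a _ b hb => ?_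
  rw [List.mem_range'_1] at hb
  rw [h.p_eq (by omega)]

lemma IsSub.branches_of_p_eq {pre : List (List ℕ)} {br : List ℕ} (h : G.IsSub H)
    (hp : H.p (l + 1) = l) (hb : G.branches = pre ++ [br ++ [l]]) :
    H.branches = pre ++ [br ++ [l] ++ [l + 1]] := by
  rw [Genogram.branches, range'_succ_eq]
  exact List.splitBy_concat_of_rel (h.splitBy_eq.trans hb) (by simpa using hp)

lemma IsSub.branches_of_p_ne (h : G.IsSub H) (hp : H.p (l + 1) ≠ l) :
    H.branches = G.branches ++ [[l + 1]] := by
  rw [Genogram.branches, range'_succ_eq, ← h.splitBy_eq]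
  refine List.splitBy_concat_of_not_rel (a := l) ?_ (by simpa using hp)
  rw [range'_eq_concat G.one_le_order]
  simp

section

variable {pre : List (List ℕ)} {br : List ℕ} {bls : List (List ℕ)} {b : List ℕ}

lemma Decomp.blocks_of_isSub (D : G.Decomp pre br bls b) (h : G.IsSub H) :
    H.blocks (br ++ [l]) = bls ++ [b ++ [l]] := by
  rw [← D.blocks]
  refine List.splitBy_congr fun a _ x hx => ?_
  have : x ≤ l := by
    rcases List.mem_append.1 hx with hx | hx
    · exact (D.lt_of_mem_br x hx).le
    · rw [List.mem_singleton.1 hx]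
  rw [h.s_eq this]

lemma Decomp.lt_succ_of_mem_br (D : G.Decomp pre br bls b) : ∀ x ∈ br ++ [l], x < l + 1 := by
  intro x hx
  rcases List.mem_append.1 hx with hx | hx
  · have := D.lt_of_mem_br x hx; omega
  · rw [List.mem_singleton.1 hx]; omega

lemma Decomp.lt_succ_of_mem_b (D : G.Decomp pre br bls b) : ∀ x ∈ b ++ [l], x < l + 1 := by
  intro x hx
  rcases List.mem_append.1 hx with hx | hx
  · have := D.lt_of_mem_b x hx; omega
  · rw [List.mem_singleton.1 hx]; omega

lemma Decomp.of_neg (D : G.Decomp pre br bls b) (h : G.IsSub H) (hs : H.s (l + 1) < 0) :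
    H.Decomp pre (br ++ [l]) bls (b ++ [l]) where
  branches := h.branches_of_p_eq (h.of_neg hs).1 D.branches
  blocks := List.splitBy_concat_of_rel (D.blocks_of_isSub h) (by simpa using hs)
  lt_of_mem_pre m hm x hx := (D.lt_of_mem_pre m hm x hx).trans (Nat.lt_succ_self l)
  lt_of_mem_br := D.lt_succ_of_mem_br
  lt_of_mem_bls m hm x hx := (D.lt_of_mem_bls m hm x hx).trans (Nat.lt_succ_self l)
  lt_of_mem_b := D.lt_succ_of_mem_b

lemma Decomp.of_child (D : G.Decomp pre br bls b) (h : G.IsSub H) (hp : H.p (l + 1) = l)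
    (hs : 0 ≤ H.s (l + 1)) : H.Decomp pre (br ++ [l]) (bls ++ [b ++ [l]]) [] where
  branches := h.branches_of_p_eq hp D.branches
  blocks := by
    have := D.blocks_of_isSub h
    rw [Genogram.blocks] at this ⊢
    rw [List.splitBy_concat_of_not_rel (a := l) (by simp) (by simpa using hs), this]
    rfl
  lt_of_mem_pre m hm x hx := (D.lt_of_mem_pre m hm x hx).trans (Nat.lt_succ_self l)
  lt_of_mem_br := D.lt_succ_of_mem_br
  lt_of_mem_bls m hm x hx := by
    rcases List.mem_append.1 hm with hm | hm
    · exact (D.lt_of_mem_bls m hm x hx).trans (Nat.lt_succ_self l)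
    · rw [List.mem_singleton.1 hm] at hx
      exact D.lt_succ_of_mem_b x hx
  lt_of_mem_b := by simp

lemma Decomp.of_branch (D : G.Decomp pre br bls b) (h : G.IsSub H) (hp : H.p (l + 1) ≠ l) :
    H.Decomp (pre ++ [br ++ [l]]) [] [] [] where
  branches := by rw [h.branches_of_p_ne hp, D.branches]; rfl
  blocks := rfl
  lt_of_mem_pre m hm x hx := by
    rcases List.mem_append.1 hm with hm | hm
    · exact (D.lt_of_mem_pre m hm x hx).trans (Nat.lt_succ_self l)
    · rw [List.mem_singleton.1 hm] at hx
      exact D.lt_succ_of_mem_br x hx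
  lt_of_mem_br := by simp
  lt_of_mem_bls := by simp
  lt_of_mem_b := by simp

end

lemma calE_eq_calE_update_self (H : Genogram l) (Y : ℕ → Ω → ℝ) :
    H.calE μ Y = H.calE μ (Function.update Y l (Y l)) := by
  rw [Function.update_eq_self]

/-- Appending a negative vertex multiplies the last argument into the last block. -/
lemma IsSub.calE_of_neg (h : G.IsSub H) (hs : H.s (l + 1) < 0) (Y : ℕ → Ω → ℝ) (F : Ω → ℝ) :
    H.calE μ (Function.update Y (l + 1) F) =
        G.calE μ (Function.update Y l fun ω => Y l ω * F ω) ∧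
      (H.EDefined μ (Function.update Y (l + 1) F) ↔
        G.EDefined μ (Function.update Y l fun ω => Y l ω * F ω)) := by
  obtain ⟨pre, br, bls, b, D⟩ := G.exists_decomp
  have D' := D.of_neg h hs
  have hb := D.blockProducts_pre h Y Y fun _ _ => rfl
  have hc : ∀ ω, ((b ++ [l]).map fun t => Y t ω).prod * F ω =
      (b.map fun t => Y t ω).prod * (Y l ω * F ω) := fun ω => by simp [mul_assoc]
  rw [D.calE_update, D'.calE_update, D.eDefined_update, D'.eDefined_update]
  simp_rw [hc]
  refine ⟨?_, ?_⟩
  · congr 2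
    exact List.map_congr_left fun m hm => by rw [hb m hm]
  · refine and_congr_left' (forall₂_congr fun m hm => ?_)
    rw [hb m hm]

/-- Appending a non-negative child of the last vertex replaces the last argument by its
covariance with the last block. -/
lemma IsSub.calE_of_child (h : G.IsSub H) (hp : H.p (l + 1) = l) (hs : 0 ≤ H.s (l + 1))
    (Y : ℕ → Ω → ℝ) (F : Ω → ℝ) (hY : G.EDefined μ Y)
    (hF : H.EDefined μ (Function.update Y (l + 1) F)) :
    (H.calE μ (Function.update Y (l + 1) F) =
        G.calE μ (Function.update Y l fun ω => Y l ω * F ω) - G.calE μ Y * ∫ ω, F ω ∂μ) ∧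
      G.EDefined μ (Function.update Y l fun ω => Y l ω * F ω) ∧ Integrable F μ := by
  obtain ⟨pre, br, bls, b, D⟩ := G.exists_decomp
  have D' := D.of_child h hp hs
  have hb := D.blockProducts_pre h Y Y fun _ _ => rfl
  rw [D'.eDefined_update] at hF
  have hl : lastInit (bls ++ [b ++ [l]]) Y =
      lastInit bls Y ++ [fun ω => (b.map fun t => Y t ω).prod * Y l ω] := by
    simp [lastInit]
  have hY' := hY
  rw [← Function.update_eq_self l Y, D.eDefined_update] at hY'
  simp only [hl, List.map_nil, List.prod_nil, one_mul] at hF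
  have hm : DstarDefined μ
      (lastInit bls Y ++ [fun ω => (b.map fun t => Y t ω).prod * Y l ω * F ω]) :=
    hF.2.merge_last
  have hc : ∀ ω, (b.map fun t => Y t ω).prod * Y l ω * F ω =
      (b.map fun t => Y t ω).prod * (Y l ω * F ω) := fun ω => by ring
  refine ⟨?_, ?_, hF.2.integrable_last⟩
  · rw [D'.calE_update, calE_eq_calE_update_self G Y, D.calE_update, D.calE_update, hl]
    simp only [List.map_nil, List.prod_nil, one_mul]
    have hpre : (pre.map fun m => calDstar μ (H.blockProducts Y m)) =
        pre.map fun m => calDstar μ (G.blockProducts Y m) :=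
      List.map_congr_left fun m hm => by rw [hb m hm]
    rw [calDstar_concat_concat _ _ _ hY'.2 hm, hpre]
    simp_rw [hc]
    ring
  · rw [D.eDefined_update]
    refine ⟨hY'.1, ?_⟩
    simp_rw [hc] at hm
    exact hm

/-- Appending a vertex that starts a new branch gives an expectation as a new factor. -/
lemma IsSub.calE_of_branch (h : G.IsSub H) (hp : H.p (l + 1) ≠ l)
    (Y : ℕ → Ω → ℝ) (F : Ω → ℝ) :
    (H.calE μ (Function.update Y (l + 1) F) = G.calE μ Y * ∫ ω, F ω ∂μ) ∧
      (H.EDefined μ (Function.update Y (l + 1) F) → Integrable F μ) := by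
  obtain ⟨pre, br, bls, b, D⟩ := G.exists_decomp
  have D' := D.of_branch h hp
  have hb : ∀ m ∈ G.branches, H.blockProducts Y m = G.blockProducts Y m := by
    intro m hm
    refine blockProducts_congr (fun x hx => h.s_eq ?_) fun _ _ => rfl
    have := List.mem_of_mem_splitBy hm hx
    rw [List.mem_range'_1] at this
    omega
  rw [D'.calE_update, D'.eDefined_update, ← D.branches, calE]
  simp only [lastInit, List.map_nil, List.prod_nil, one_mul, List.nil_append]
  refine ⟨?_, fun h' => DstarDefined.integrable_last (L := []) h'.2⟩
  have hpre : (G.branches.map fun m => calDstar μ (H.blockProducts Y m)) =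
      G.branches.map fun m => calDstar μ (G.blockProducts Y m) :=
    List.map_congr_left fun m hm => by rw [hb m hm]
  rw [hpre]
  simp [calDstar, calD]

end Ext

end Genogram

/-! ### Iterated sums over the running indices -/

namespace Genogram

section IterSum

variable {k : ℕ} (G : Genogram k) {d : ℕ} (T : Finset (Fin d → ℤ)) (m : ℕ)
  (r : (Fin d → ℤ) → (Fin d → ℤ) → Prop)

lemma image_A_congr {j : ℕ} {i i' : ℕ → Fin d → ℤ} (h : ∀ t < j, i t = i' t) :
    (G.A j).image i = (G.A j).image i' :=
  Finset.image_congr fun t ht => h t (G.lt_of_mem_A ht)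

lemma inner_congr {j : ℕ} (h1 : 1 ≤ j) (hk : j ≤ k) {i i' : ℕ → Fin d → ℤ}
    (h : ∀ t < j, i t = i' t) : G.inner T m r i j = G.inner T m r i' j := by
  induction j using Nat.strong_induction_on with
  | _ j ih =>
  rcases Nat.lt_or_ge 1 j with h2 | h2
  · have hlt := G.p_lt' h2
    rw [G.inner_eq T m r i h2 hk, G.inner_eq T m r i' h2 hk, G.image_A_congr h,
      ih _ hlt (G.p_pos h2 hk) (hlt.le.trans hk) fun t ht => h t (ht.trans hlt)]
  · rw [show j = 1 by omega, inner_one, inner_one]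

lemma outer_congr {j : ℕ} (h1 : 1 ≤ j) (hk : j ≤ k) {i i' : ℕ → Fin d → ℤ}
    (h : ∀ t < j, i t = i' t) : G.outer T m r i j = G.outer T m r i' j := by
  induction j using Nat.strong_induction_on with
  | _ j ih =>
  rcases Nat.lt_or_ge 1 j with h2 | h2
  · have hlt := G.p_lt' h2
    have hp := G.p_pos h2 hk
    rcases lt_or_ge (G.s j) 0 with hs | hs
    · rw [G.outer_of_neg T m r i h2 hk hs, G.outer_of_neg T m r i' h2 hk hs]
      exact ih _ hlt hp (hlt.le.trans hk) fun t ht => h t (ht.trans hlt)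
    · rw [G.outer_of_nonneg T m r i h2 hk hs, G.outer_of_nonneg T m r i' h2 hk hs,
        G.image_A_congr h,
        G.inner_congr T m r hp (hlt.le.trans hk) fun t ht => h t (ht.trans hlt)]
  · rw [show j = 1 by omega, outer_one, outer_one]

lemma idxRange_congr {j : ℕ} (h1 : 1 ≤ j) (hk : j ≤ k) {i i' : ℕ → Fin d → ℤ}
    (h : ∀ t < j, i t = i' t) : G.idxRange T m r i j = G.idxRange T m r i' j := by
  rw [idxRange, idxRange, G.outer_congr T m r h1 hk h, G.inner_congr T m r h1 hk h]

lemma iterSumFrom_congr {l : ℕ} {G : Genogram k} {H : Genogram l}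
    {F F' : (ℕ → Fin d → ℤ) → ℝ} {j n : ℕ} (hj : 1 ≤ j) (hn : j + n ≤ k + 1)
    (hGH : ∀ i, ∀ t ∈ Finset.Ico j (j + n), G.idxRange T m r i t = H.idxRange T m r i t)
    {i : ℕ → Fin d → ℤ}
    (h : ∀ i', (∀ t < j, i' t = i t) →
      (∀ t ∈ Finset.Ico j (j + n), i' t ∈ G.idxRange T m r i' t) → F i' = F' i') :
    G.iterSumFrom T m r F j n i = H.iterSumFrom T m r F' j n i := by
  induction n generalizing j i with
  | zero => exact h i (fun _ _ => rfl) (by simp)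
  | succ n ih =>
    rw [iterSumFrom, iterSumFrom, hGH i j (by simp)]
    refine Finset.sum_congr rfl fun x hx => ih (by omega) (by omega) ?_ ?_
    · exact fun i' t ht => hGH i' t (by rw [Finset.mem_Ico] at *; omega)
    · intro i' hi' hi''
      have hlt : ∀ t < j, i' t = i t := fun t ht => by
        rw [hi' t (by omega), Function.update_of_ne ht.ne]
      refine h i' hlt fun t ht => ?_
      rw [Finset.mem_Ico] at ht
      rcases ht.1.eq_or_lt with rfl | hjt
      · rw [hi' j (by omega), Function.update_self,
          G.idxRange_congr T m r hj (by omega) hlt, hGH i j (by simp)]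
        exact hx
      · exact hi'' t (by rw [Finset.mem_Ico]; omega)

lemma iterSumFrom_succ' (F : (ℕ → Fin d → ℤ) → ℝ) (j n : ℕ) (i : ℕ → Fin d → ℤ) :
    G.iterSumFrom T m r F j (n + 1) i =
      G.iterSumFrom T m r
        (fun i' => ∑ x ∈ G.idxRange T m r i' (j + n), F (Function.update i' (j + n) x)) j n i := by
  induction n generalizing j i with
  | zero => rfl
  | succ n ih =>
    rw [iterSumFrom]
    conv_rhs => rw [iterSumFrom]
    refine Finset.sum_congr rfl fun x _ => ?_
    rw [ih, show j + 1 + n = j + (n + 1) by omega]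

lemma iterSumFrom_sum {ι : Type*} (S : Finset ι) (c : ι → ℝ) (F : ι → (ℕ → Fin d → ℤ) → ℝ)
    (j n : ℕ) (i : ℕ → Fin d → ℤ) :
    G.iterSumFrom T m r (fun i => ∑ x ∈ S, c x * F x i) j n i =
      ∑ x ∈ S, c x * G.iterSumFrom T m r (F x) j n i := by
  induction n generalizing j i with
  | zero => rfl
  | succ n ih =>
    simp only [iterSumFrom, ih, Finset.mul_sum]
    exact Finset.sum_comm

/-- Only admissible tuples matter in an iterated sum. -/
lemma iterSum_congr {F F' : (ℕ → Fin d → ℤ) → ℝ} {n : ℕ} (hn : n ≤ k)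
    (h : ∀ i, G.Admissible T m r n i → F i = F' i) :
    G.iterSum T m r n F = G.iterSum T m r n F' := by
  refine iterSumFrom_congr T m r le_rfl (by omega) (fun _ _ _ => rfl) fun i _ hi => h i ?_
  intro t ht
  exact hi t (by rw [Finset.mem_Icc] at ht; rw [Finset.mem_Ico]; omega)

lemma IsSub.iterSum_eq {l : ℕ} {H : Genogram l} {G : Genogram k} (h : G.IsSub H) {n : ℕ}
    (hn : n ≤ k) (F : (ℕ → Fin d → ℤ) → ℝ) : H.iterSum T m r n F = G.iterSum T m r n F := by
  refine iterSumFrom_congr T m r le_rfl (by have := h.1; omega) (fun i t ht => ?_) fun _ _ _ => rfl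
  rw [Finset.mem_Ico] at ht
  exact h.idxRange_eq T m r i (by omega) (by omega)

lemma iterSum_succ (n : ℕ) (F : (ℕ → Fin d → ℤ) → ℝ) :
    G.iterSum T m r (n + 1) F =
      G.iterSum T m r n fun i =>
        ∑ x ∈ G.idxRange T m r i (n + 1), F (Function.update i (n + 1) x) := by
  rw [iterSum, iterSumFrom_succ', iterSum]
  simp only [add_comm 1 n]

lemma iterSum_sum {ι : Type*} (S : Finset ι) (c : ι → ℝ) (F : ι → (ℕ → Fin d → ℤ) → ℝ) (n : ℕ) :
    G.iterSum T m r n (fun i => ∑ x ∈ S, c x * F x i) = ∑ x ∈ S, c x * G.iterSum T m r n (F x) :=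
  G.iterSumFrom_sum T m r S c F 1 n _

lemma iterSum_const_mul (c : ℝ) (F : (ℕ → Fin d → ℤ) → ℝ) (n : ℕ) :
    G.iterSum T m r n (fun i => c * F i) = c * G.iterSum T m r n F := by
  simpa using G.iterSum_sum T m r {()} (fun _ => c) (fun _ => F) n

lemma iterSum_add (F F' : (ℕ → Fin d → ℤ) → ℝ) (n : ℕ) :
    G.iterSum T m r n (fun i => F i + F' i) = G.iterSum T m r n F + G.iterSum T m r n F' := by
  simpa using G.iterSum_sum T m r Finset.univ (fun _ => 1) ![F, F'] n

lemma iterSum_eq_zero {F : (ℕ → Fin d → ℤ) → ℝ} {n : ℕ} (hn : n ≤ k)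
    (h : ∀ i, G.Admissible T m r n i → F i = 0) : G.iterSum T m r n F = 0 := by
  rw [G.iterSum_congr T m r hn (F' := fun _ => 0 * 0) (by simpa using h), iterSum_const_mul,
    zero_mul]

lemma Admissible.update {n : ℕ} {G : Genogram k} {i : ℕ → Fin d → ℤ}
    (h : G.Admissible T m r n i) (hn : n + 1 ≤ k) {x : Fin d → ℤ}
    (hx : x ∈ G.idxRange T m r i (n + 1)) :
    G.Admissible T m r (n + 1) (Function.update i (n + 1) x) := by
  intro j hj
  rw [Finset.mem_Icc] at hj
  have hc : ∀ t < j, Function.update i (n + 1) x t = i t := fun t ht =>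
    Function.update_of_ne (by omega) _ _
  rw [G.idxRange_congr T m r hj.1 (hj.2.trans hn) hc]
  rcases hj.2.eq_or_lt with rfl | hlt
  · rwa [Function.update_self]
  · rw [Function.update_of_ne (by omega)]
    exact h j (Finset.mem_Icc.2 ⟨hj.1, by omega⟩)

end IterSum

end Genogram

/-! ### Integration by parts along a segment -/

section Segment

lemma integral_pow_mul_segment {F F' : ℝ → ℝ} (hF : ∀ x, HasDerivAt F (F' x) x)
    (hF' : Continuous F') (a b : ℝ) (q : ℕ) :
    (a - b) * (∫ v in (0 : ℝ)..1, v ^ q * F' (v * a + (1 - v) * b)) =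
      F a - 0 ^ q * F b - ∫ v in (0 : ℝ)..1, (q : ℝ) * v ^ (q - 1) * F (v * a + (1 - v) * b) := by
  have hFc : Continuous F := continuous_iff_continuousAt.2 fun x => (hF x).continuousAt
  have hd : ∀ v ∈ Set.uIcc (0 : ℝ) 1, HasDerivAt (fun v => v ^ q * F (v * a + (1 - v) * b))
      ((q : ℝ) * v ^ (q - 1) * F (v * a + (1 - v) * b) +
        (a - b) * (v ^ q * F' (v * a + (1 - v) * b))) v := by
    intro v _
    have h1 : HasDerivAt (fun v : ℝ => v * a + (1 - v) * b) (1 * a + (0 - 1) * b) v :=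
      ((hasDerivAt_id v).mul_const a).add
        (((hasDerivAt_const v 1).sub (hasDerivAt_id v)).mul_const b)
    have h2 := (hasDerivAt_pow q v).mul ((hF (v * a + (1 - v) * b)).comp v h1)
    refine h2.congr_deriv ?_
    simp only [Function.comp_apply]
    ring
  have i1 : IntervalIntegrable (fun v => (q : ℝ) * v ^ (q - 1) * F (v * a + (1 - v) * b))
      volume 0 1 := by
    apply Continuous.intervalIntegrable; fun_prop
  have i2 : IntervalIntegrable (fun v => (a - b) * (v ^ q * F' (v * a + (1 - v) * b)))
      volume 0 1 := by
    apply Continuous.intervalIntegrable; fun_prop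
  have h := intervalIntegral.integral_eq_sub_of_hasDerivAt hd (i1.add i2)
  rw [intervalIntegral.integral_add i1 i2, intervalIntegral.integral_const_mul] at h
  have h' : (fun v : ℝ => v ^ q * F (v * a + (1 - v) * b)) 1 -
      (fun v : ℝ => v ^ q * F (v * a + (1 - v) * b)) 0 = F a - 0 ^ q * F b := by simp
  rw [h'] at h
  linarith

lemma integral_weighted_sub {F : ℝ → ℝ} (hF : Continuous F) (a b : ℝ) (q : ℕ) :
    ∫ v in (0 : ℝ)..1, ((q : ℝ) + 1) * v ^ q * (F (v * a + (1 - v) * b) - F a) =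
      (∫ v in (0 : ℝ)..1, ((q : ℝ) + 1) * v ^ q * F (v * a + (1 - v) * b)) - F a := by
  have i1 : IntervalIntegrable (fun v => ((q : ℝ) + 1) * v ^ q * F (v * a + (1 - v) * b))
      volume 0 1 := by
    apply Continuous.intervalIntegrable; fun_prop
  have i2 : IntervalIntegrable (fun v => ((q : ℝ) + 1) * v ^ q * F a) volume 0 1 := by
    apply Continuous.intervalIntegrable; fun_prop
  simp_rw [mul_sub]
  rw [intervalIntegral.integral_sub i1 i2]
  congr 1
  rw [intervalIntegral.integral_mul_const, intervalIntegral.integral_const_mul, integral_pow]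
  have : (q : ℝ) + 1 ≠ 0 := by positivity
  field_simp
  simp

/-- First-order expansion of a difference along a segment. The trivial weight `(0 + 1) v ^ 0` is the
case `q = 0` of the weights `(q + 1) v ^ q` in the adjusted differences. -/
lemma sub_eq_segment {F F' : ℝ → ℝ} (hF : ∀ x, HasDerivAt F (F' x) x)
    (hF' : Continuous F') (a b : ℝ) :
    F b - F a = -(a - b) *
      (F' a +
        ∫ v in (0 : ℝ)..1, ((0 : ℕ) + 1 : ℝ) * v ^ 0 * (F' (v * a + (1 - v) * b) - F' a)) := by
  have h := integral_pow_mul_segment hF hF' a b 0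
  rw [integral_weighted_sub hF' a b 0]
  simp only [pow_zero, one_mul, CharP.cast_eq_zero, zero_mul, intervalIntegral.integral_zero,
    zero_add, sub_zero] at h ⊢
  linarith

/-- First-order expansion of a weighted mean of differences along a segment. -/
lemma integral_sub_eq_segment {F F' : ℝ → ℝ} (hF : ∀ x, HasDerivAt F (F' x) x)
    (hF' : Continuous F') (a b : ℝ) (q : ℕ) :
    ∫ v in (0 : ℝ)..1, ((q : ℝ) + 1) * v ^ q * (F (v * a + (1 - v) * b) - F a) =
      -(1 / ((q : ℝ) + 2)) * (a - b) * (F' a +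
        ∫ v in (0 : ℝ)..1, ((q + 1 : ℕ) + 1 : ℝ) * v ^ (q + 1) *
          (F' (v * a + (1 - v) * b) - F' a)) := by
  have hFc : Continuous F := continuous_iff_continuousAt.2 fun x => (hF x).continuousAt
  have h := integral_pow_mul_segment hF hF' a b (q + 1)
  rw [integral_weighted_sub hFc a b q, integral_weighted_sub hF' a b (q + 1)]
  simp only [mul_assoc, intervalIntegral.integral_const_mul, Nat.add_sub_cancel] at h ⊢
  rw [zero_pow (by omega)] at h
  have h2 : (q : ℝ) + 2 ≠ 0 := by positivity
  push_cast at h ⊢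
  generalize (∫ v in (0 : ℝ)..1, v ^ (q + 1) * F' (v * a + (1 - v) * b)) = I at h ⊢
  generalize (∫ v in (0 : ℝ)..1, v ^ q * F (v * a + (1 - v) * b)) = J at h ⊢
  field_simp
  linear_combination ((q : ℝ) + 2) * h

end Segment

/-! ### Expansion of `𝒰_f` -/

section

variable {Ω : Type*} [MeasurableSpace Ω] (μ : Measure Ω) {d : ℕ} (T : Finset (Fin d → ℤ))
  (X : (Fin d → ℤ) → Ω → ℝ)

lemma fieldW_sub_fieldW {D B : Finset (Fin d → ℤ)} (hDB : D ⊆ B) (hB : B ⊆ T) (ω : Ω) :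
    fieldW μ T X D ω - fieldW μ T X B ω = (fieldSigma μ T X)⁻¹ * ∑ x ∈ B \ D, X x ω := by
  have h1 := Finset.sum_sdiff (f := fun x => X x ω) (hDB.trans hB)
  have h2 := Finset.sum_sdiff (f := fun x => X x ω) hB
  have h3 := Finset.sum_sdiff (f := fun x => X x ω) hDB
  rw [fieldW, fieldW, ← mul_sub]
  congr 1
  linarith

lemma fieldW_self (ω : Ω) : fieldW μ T X T ω = 0 := by
  simp [fieldW]

variable (m : ℕ) (r : (Fin d → ℤ) → (Fin d → ℤ) → Prop) {f : ℝ → ℝ}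

namespace Genogram

variable {l : ℕ} {H : Genogram l} {K : Genogram (l + 1)}

/-- The adjusted difference of `H`, expanded to first order; the remainder is the adjusted
difference of the genogram `K` that has a negative vertex appended to `H`. -/
lemma IsSub.adjDiff_eq (h : H.IsSub K) (hs : K.s (l + 1) < 0)
    (hf : ContDiff ℝ ((l - 1 : ℕ) : WithTop ℕ∞) f) (i : ℕ → Fin d → ℤ) (ω : Ω) :
    H.adjDiff μ T X m r f i ω =
      ∑ x ∈ H.idxRange T m r i l, -(1 / ((l : ℝ) + 1 - H.u l)) * (fieldSigma μ T X)⁻¹ *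
        (X x ω * (iteratedDeriv (l - 1) f (fieldW μ T X (H.inner T m r i l) ω) +
          K.adjDiff μ T X m r f (Function.update i l x) ω)) := by
  obtain ⟨hp, -, h2⟩ := h.of_neg hs
  obtain ⟨t, rfl⟩ : ∃ t, l = t + 2 := ⟨l - 2, by omega⟩
  have hsub : fieldW μ T X (H.inner T m r i (t + 2)) ω -
      fieldW μ T X (H.outer T m r i (t + 2)) ω = _ :=
    fieldW_sub_fieldW μ T X (H.inner_subset_outer T m r i (by omega) le_rfl)
      (H.outer_subset T m r i (by omega) le_rfl) ω
  have hK : ∀ x, K.adjDiff μ T X m r f (Function.update i (t + 2) x) ω =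
      ∫ v in (0 : ℝ)..1, (((t + 2 - H.u (t + 2) : ℕ) : ℝ) + 1) * v ^ (t + 2 - H.u (t + 2)) *
        (iteratedDeriv (t + 1) f (v * fieldW μ T X (H.inner T m r i (t + 2)) ω +
            (1 - v) * fieldW μ T X (H.outer T m r i (t + 2)) ω) -
          iteratedDeriv (t + 1) f (fieldW μ T X (H.inner T m r i (t + 2)) ω)) := by
    intro x
    have hu : K.u (t + 2 + 1) = H.u (t + 2) := by
      rw [K.u_of_neg (by omega) le_rfl hs, hp, h.u_eq le_rfl]
    have hul := H.u_le (t + 2)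
    have hc : ∀ j < t + 2, Function.update i (t + 2) x j = i j := fun j hj =>
      Function.update_of_ne hj.ne _ _
    rw [adjDiff, hu, if_neg (by omega), K.inner_of_neg T m r _ (by omega) le_rfl hs,
      K.outer_of_neg T m r _ (by omega) le_rfl hs, hp, h.inner_eq T m r _ (by omega) le_rfl,
      h.outer_eq T m r _ (by omega) le_rfl, H.inner_congr T m r (by omega) le_rfl hc,
      H.outer_congr T m r (by omega) le_rfl hc]
    have he : (((t + 2 + 1 : ℕ) : ℝ) - H.u (t + 2)) = ((t + 2 - H.u (t + 2) : ℕ) : ℝ) + 1 := by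
      rw [Nat.cast_sub hul]; push_cast; ring
    rw [he]
    rfl
  have hd : ∀ x, HasDerivAt (iteratedDeriv t f) (iteratedDeriv (t + 1) f x) x := fun x => by
    rw [iteratedDeriv_succ]
    refine (hf.differentiable_iteratedDeriv t ?_ x).hasDerivAt
    exact_mod_cast Nat.lt_succ_self t
  have hc : Continuous (iteratedDeriv (t + 1) f) := hf.continuous_iteratedDeriv (t + 1) le_rfl
  simp_rw [hK]
  rw [← Finset.mul_sum, ← Finset.sum_mul, mul_assoc, ← mul_assoc _ (∑ x ∈ _, _), idxRange, ← hsub]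
  have hul := H.u_le (t + 2)
  rw [adjDiff]
  simp only [Nat.add_sub_cancel, show t + 2 - 1 = t + 1 by omega]
  split_ifs with hu
  · rw [sub_eq_segment hd hc, hu]
    simp
    ring
  · obtain ⟨q, hq⟩ : ∃ q, t + 2 = H.u (t + 2) + q + 1 := ⟨t + 1 - H.u (t + 2), by omega⟩
    have hq' : ((t : ℝ) + 2) = (H.u (t + 2) : ℝ) + q + 1 := by exact_mod_cast hq
    have key := integral_sub_eq_segment hd hc (fieldW μ T X (H.inner T m r i (t + 2)) ω)
      (fieldW μ T X (H.outer T m r i (t + 2)) ω) q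
    rw [show t + 2 - H.u (t + 2) = q + 1 by omega, show t + 1 - H.u (t + 2) = q by omega]
    push_cast at key ⊢
    rw [show (t : ℝ) + 2 - H.u (t + 2) = q + 1 by linarith,
      show (t : ℝ) + 2 + 1 - H.u (t + 2) = q + 2 by linarith, key]
    ring

/-- Taylor step: `𝒰_f(H)` in terms of `𝒯_f(H)` and the `𝒰_f` of the genogram that has a negative
vertex appended to `H`. -/
lemma IsSub.sumU_eq (h : H.IsSub K) (hs : K.s (l + 1) < 0)
    (hf : ContDiff ℝ ((l - 1 : ℕ) : WithTop ℕ∞) f) (hT : H.TDefined μ T X m r f)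
    (hU : K.UDefined μ T X m r f) :
    H.sumU μ T X m r f =
      -(1 / ((l : ℝ) + 1 - H.u l)) * (H.sumT μ T X m r f + K.sumU μ T X m r f) := by
  obtain ⟨hp, -, h2⟩ := h.of_neg hs
  obtain ⟨t, rfl⟩ : ∃ t, l = t + 1 := ⟨l - 1, by omega⟩
  set c : ℝ := -(1 / (((t + 1 : ℕ) : ℝ) + 1 - H.u (t + 1)))
  set σ := (fieldSigma μ T X)⁻¹
  -- the expansion for fixed running indices `i_1, …, i_t`
  have key : ∀ i, H.Admissible T m r t i →
      H.calE μ (H.argU μ T X m r f i) =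
        c * σ * ∑ x ∈ H.idxRange T m r i (t + 1),
          (H.calE μ (H.argT μ T X m r f (Function.update i (t + 1) x)) +
            K.calE μ (K.argU μ T X m r f (Function.update i (t + 1) x))) := by
    intro i hi
    have hargS : ∀ x, argS X (Function.update i (t + 1) x) =
        Function.update (argS X i) (t + 1) (X x) := fun x => by
      funext j
      rcases eq_or_ne j (t + 1) with rfl | hj
      · simp [argS]
      · simp [argS, hj]
    have hcg : ∀ x, ∀ j < t + 1, Function.update i (t + 1) x j = i j := fun x j hj =>
      Function.update_of_ne hj.ne _ _
    have hargT : ∀ x, H.argT μ T X m r f (Function.update i (t + 1) x) =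
        Function.update (argS X i) (t + 1) fun ω => X x ω *
          iteratedDeriv t f (fieldW μ T X (H.inner T m r i (t + 1)) ω) := fun x => by
      rw [argT, hargS, Function.update_idem, Function.update_self,
        H.inner_congr T m r (by omega) le_rfl (hcg x)]
      rfl
    have hK := fun x => h.calE_of_neg (μ := μ) hs (Function.update (argS X i) (t + 1) (X x))
      (K.adjDiff μ T X m r f (Function.update i (t + 1) x))
    simp only [Function.update_idem, Function.update_self] at hK
    have hargU : ∀ x, K.argU μ T X m r f (Function.update i (t + 1) x) =
        Function.update (Function.update (argS X i) (t + 1) (X x)) (t + 1 + 1)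
          (K.adjDiff μ T X m r f (Function.update i (t + 1) x)) := fun x => by
      rw [argU, hargS]
    have hadm : ∀ x ∈ H.idxRange T m r i (t + 1),
        H.Admissible T m r (t + 1) (Function.update i (t + 1) x) := fun x hx =>
      hi.update T m r le_rfl hx
    have d1 : ∀ x ∈ H.idxRange T m r i (t + 1), H.EDefined μ (Function.update (argS X i) (t + 1)
        fun ω => X x ω * iteratedDeriv t f (fieldW μ T X (H.inner T m r i (t + 1)) ω)) :=
      fun x hx => hargT x ▸ hT _ (hadm x hx)
    have d2 : ∀ x ∈ H.idxRange T m r i (t + 1), H.EDefined μ (Function.update (argS X i) (t + 1)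
        fun ω => X x ω * K.adjDiff μ T X m r f (Function.update i (t + 1) x) ω) :=
      fun x hx => (hK x).2.1 <| hargU x ▸ hU _ ((h.admissible_iff T m r _ le_rfl).2 (hadm x hx))
    have lin := calE_update_sum (G := H) (μ := μ)
      (H.idxRange T m r i (t + 1) ×ˢ (Finset.univ : Finset Bool)) (fun _ => c * σ)
      (fun y ω => X y.1 ω * cond y.2
        (iteratedDeriv t f (fieldW μ T X (H.inner T m r i (t + 1)) ω))
        (K.adjDiff μ T X m r f (Function.update i (t + 1) y.1) ω)) (argS X i) (by
          rintro ⟨x, b⟩ hx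
          have hx := (Finset.mem_product.1 hx).1
          cases b
          · exact d2 x hx
          · exact d1 x hx)
    rw [argU, show H.adjDiff μ T X m r f i = _ from funext (h.adjDiff_eq μ T X m r hs hf i),
      Finset.mul_sum]
    simp only [Finset.sum_product, Fintype.sum_bool, cond_true, cond_false] at lin
    simp only [hargT, hargU, (hK _).1, mul_add, Nat.add_sub_cancel]
    exact lin
  rw [sumU, sumT, sumU]
  simp only [Nat.add_sub_cancel]
  rw [H.iterSum_congr T m r (by omega) key, iterSum_const_mul, h.iterSum_eq T m r le_rfl,
    ← mul_add, ← iterSum_add, iterSum_succ, pow_succ]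
  ring

end Genogram

end

/-! ### Genograms with bounded identifiers -/

namespace Genogram

lemma finite_bounded (n N : ℕ) : {H : Genogram n | ∀ j, H.s j ≤ N}.Finite := by
  have hfin : (Set.univ.pi fun _ : Fin (n + 1) => Set.Icc 0 n ×ˢ Set.Icc (-1 : ℤ) N).Finite :=
    Set.Finite.pi fun _ => (Set.finite_Icc _ _).prod (Set.finite_Icc _ _)
  refine Set.Finite.of_finite_image (f := fun H (j : Fin (n + 1)) => (H.p j, H.s j))
    (hfin.subset ?_) ?_
  · rintro _ ⟨H, hH, rfl⟩ j -
    refine ⟨⟨Nat.zero_le _, ?_⟩, ?_, hH j⟩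
    · change H.p j ≤ n
      rcases Nat.eq_zero_or_pos (j : ℕ) with h | h
      · rw [h, H.p_zero]; exact Nat.zero_le _
      · have := H.p_lt h; omega
    · by_cases h : (j : ℕ) ∈ Finset.Icc 2 n
      · exact H.neg_one_le_s _ h
      · have : H.s j = 0 := by
          by_cases h1 : (j : ℕ) = 1
          · rw [h1, H.s_root]
          · exact H.s_eq_zero _ fun h' => h (by rw [Finset.mem_Icc] at *; omega)
        simp [this]
  · intro H _ H' _ h
    refine ext_of_forall fun j hj => ?_
    have := congrFun h ⟨j, by rw [Finset.mem_Icc] at hj; omega⟩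
    simpa using this

/-- The genograms of order `n` all of whose identifiers are at most `N`. -/
noncomputable def bounded (n N : ℕ) : Finset (Genogram n) := (finite_bounded n N).toFinset

lemma mem_bounded {n N : ℕ} {H : Genogram n} : H ∈ bounded n N ↔ ∀ j, H.s j ≤ N := by
  simp [bounded]

variable {l : ℕ} {G : Genogram l}

open Classical in
/-- The genograms that arise from `G` by adding a last vertex, with identifiers at most `N`. -/
noncomputable def succs (N : ℕ) (G : Genogram l) : Finset (Genogram (l + 1)) :=
  (bounded (l + 1) N).filter fun H => G.IsSub H

lemma mem_succs {N : ℕ} (hG : ∀ j, G.s j ≤ N) {H : Genogram (l + 1)} :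
    H ∈ succs N G ↔ G.IsSub H ∧ H.s (l + 1) ≤ N := by
  classical
  rw [succs, Finset.mem_filter, mem_bounded, and_comm]
  refine and_congr_right fun h => ⟨fun h' => h' _, fun h' j => ?_⟩
  rcases lt_trichotomy j (l + 1) with hj | rfl | hj
  · rw [h.s_eq (by omega)]; exact hG j
  · exact h'
  · rw [H.s_eq_zero j (by rw [Finset.mem_Icc]; omega)]; positivity

/-- A sum over the genograms that arise from `G` by adding a non-negative last vertex: this vertex
is either a child of `v[l]`, or a sibling, with a smaller identifier, of a vertex on the path from
the root to `v[l]`. -/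
lemma sum_succs_nonneg {N : ℕ} (hG : ∀ j, G.s j ≤ N) (V : ℕ → ℕ → ℝ) :
    ∑ H ∈ succs N G with 0 ≤ H.s (l + 1), V (H.p (l + 1)) (H.s (l + 1)).toNat =
      ∑ n ∈ Finset.range (N + 1), V l n +
        ∑ c ∈ G.path l, ∑ n ∈ Finset.range (G.s c).toNat, V (G.p c) n := by
  rw [← Finset.sum_filter_add_sum_filter_not _ (fun H => H.p (l + 1) = l)]
  congr 1
  · symm
    refine Finset.sum_bij (fun n _ => add (canAdd_child (G := G) (s := n) (by positivity)))
      ?_ ?_ ?_ ?_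
    · intro n hn
      rw [Finset.mem_range] at hn
      simp only [Finset.mem_filter, mem_succs hG, add_p, add_s, isSub_add, true_and, and_true]
      omega
    · intro n _ n' _ h
      have := congrArg (fun H => H.s (l + 1)) h
      simpa [add_s] using this
    · intro H hH
      simp only [Finset.mem_filter, mem_succs hG] at hH
      obtain ⟨⟨⟨hs, hN⟩, h0⟩, hp⟩ := hH
      refine ⟨(H.s (l + 1)).toNat, by rw [Finset.mem_range]; omega, ?_⟩
      refine (isSub_add _).ext hs ?_ ?_
      · rw [add_p, hp]
      · rw [add_s]; omega
    · intro n _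
      simp [add_p, add_s]
  · symm
    rw [Finset.sum_sigma']
    have hmem : ∀ a ∈ (G.path l).sigma fun c => Finset.range (G.s c).toNat,
        G.CanAdd (G.p a.1) (a.2 : ℤ) := fun a ha => by
      rw [Finset.mem_sigma, Finset.mem_range] at ha
      exact canAdd_sibling ha.1 (by positivity) (by omega)
    refine Finset.sum_bij (fun a ha => add (hmem a ha)) ?_ ?_ ?_ ?_
    · intro a ha
      have ha' := ha
      rw [Finset.mem_sigma, Finset.mem_range] at ha'
      have := G.p_lt' (G.mem_path.1 ha'.1).2
      have := G.le_of_mem_path ha'.1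
      have := hG a.1
      simp only [Finset.mem_filter, mem_succs hG, add_p, add_s, isSub_add, true_and]
      omega
    · intro a ha a' ha' h
      have h1 := congrArg (fun H => H.p (l + 1)) h
      have h2 := congrArg (fun H => H.s (l + 1)) h
      simp only [add_p, add_s, Nat.cast_inj] at h1 h2
      obtain ⟨c, n⟩ := a
      obtain ⟨c', n'⟩ := a'
      obtain rfl : c = c' := G.p_injOn_path le_rfl (Finset.mem_coe.2 (Finset.mem_sigma.1 ha).1)
        (Finset.mem_coe.2 (Finset.mem_sigma.1 ha').1) h1
      obtain rfl : n = n' := h2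
      rfl
    · intro H hH
      simp only [Finset.mem_filter, mem_succs hG] at hH
      obtain ⟨⟨⟨hs, hN⟩, h0⟩, hp⟩ := hH
      obtain ⟨c, hc, hpc, -, hlt⟩ := hs.exists_path hp
      refine ⟨⟨c, (H.s (l + 1)).toNat⟩, ?_, ?_⟩
      · rw [Finset.mem_sigma, Finset.mem_range]
        exact ⟨hc, by simp only; omega⟩
      · refine (isSub_add _).ext hs ?_ ?_
        · rw [add_p, hpc]
        · rw [add_s]; simp only; omega
    · intro a ha
      simp [add_p, add_s]

end Genogram

/-! ### Expansion of `𝒯_f` -/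

section

variable {Ω : Type*} [MeasurableSpace Ω] (μ : Measure Ω) {d : ℕ} (T : Finset (Fin d → ℤ))
  (X : (Fin d → ℤ) → Ω → ℝ) (m : ℕ) (r : (Fin d → ℤ) → (Fin d → ℤ) → Prop) (f : ℝ → ℝ)

namespace Genogram

variable {l : ℕ} (G : Genogram l)

open Classical in
/-- The increasing sequence of the constraint sets of possible children of `v[q]`: the child with
identifier `n ≥ 0` has the inner constraint set `levelSet q n` and the outer constraint set
`levelSet q (n + 1)`. -/
noncomputable def levelSet (i : ℕ → Fin d → ℤ) (q : ℕ) : ℕ → Finset (Fin d → ℤ)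
  | 0 => G.inner T m r i q
  | n + 1 => nbhdS T m r n ((insert q (G.A q)).image i) ∪ G.inner T m r i q

variable {G}

lemma IsSub.outer_last {H : Genogram (l + 1)} (h : G.IsSub H) (hs : 0 ≤ H.s (l + 1))
    (i : ℕ → Fin d → ℤ) :
    H.outer T m r i (l + 1) = G.levelSet T m r i (H.p (l + 1)) ((H.s (l + 1)).toNat + 1) := by
  have h1 := G.one_le_order
  have hp := H.p_pos (j := l + 1) (by omega) le_rfl
  have hlt := H.p_lt' (j := l + 1) (by omega)
  rw [H.outer_of_nonneg T m r i (by omega) le_rfl hs, H.A_eq' (by omega) le_rfl,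
    h.A_eq (by omega), h.inner_eq T m r i hp (by omega), levelSet, Int.toNat_of_nonneg hs]

lemma inner_eq_levelSet (i : ℕ → Fin d → ℤ) {j : ℕ} (h2 : 2 ≤ j) (hj : j ≤ l) :
    G.inner T m r i j = G.levelSet T m r i (G.p j) (G.s j).toNat := by
  rw [G.inner_eq T m r i h2 hj]
  split_ifs with hs
  · obtain ⟨n, hn⟩ : ∃ n : ℕ, G.s j = n + 1 := ⟨(G.s j - 1).toNat, by omega⟩
    rw [hn, show ((n : ℤ) + 1).toNat = n + 1 by omega, levelSet, G.A_eq' h2 hj,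
      add_sub_cancel_right]
  · rw [show (G.s j).toNat = 0 by omega, levelSet]

lemma IsSub.inner_last {H : Genogram (l + 1)} (h : G.IsSub H) (i : ℕ → Fin d → ℤ) :
    H.inner T m r i (l + 1) = G.levelSet T m r i (H.p (l + 1)) (H.s (l + 1)).toNat := by
  have h1 := G.one_le_order
  have hp := H.p_pos (j := l + 1) (by omega) le_rfl
  have hlt := H.p_lt' (j := l + 1) (by omega)
  rw [inner_eq_levelSet T m r i (by omega) le_rfl]
  cases (H.s (l + 1)).toNat with
  | zero => rw [levelSet, levelSet, h.inner_eq T m r i hp (by omega)]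
  | succ n => rw [levelSet, levelSet, h.inner_eq T m r i hp (by omega), h.A_eq (by omega)]

variable (G)

lemma levelSet_eq_self (i : ℕ → Fin d → ℤ) {n : ℕ} (hn : T.card ≤ n) {q : ℕ} (h1 : 1 ≤ q)
    (hq : q ≤ l) : G.levelSet T m r i q (n + 1) = T := by
  rw [levelSet, nbhdS_eq_self T m r (by exact_mod_cast hn)]
  exact Finset.union_eq_left.2 (G.inner_subset T m r i h1 hq)

/-- The increment of `f(W(·))` between consecutive level sets. -/
noncomputable def levelDiff (i : ℕ → Fin d → ℤ) (q n : ℕ) (ω : Ω) : ℝ :=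
  f (fieldW μ T X (G.levelSet T m r i q (n + 1)) ω) - f (fieldW μ T X (G.levelSet T m r i q n) ω)

/-- Along the children of the last vertex, the increments telescope to `f(0) - f(W(D_l))`. -/
lemma sum_levelDiff_child (i : ℕ → Fin d → ℤ) {N : ℕ} (hN : T.card ≤ N) (ω : Ω) :
    ∑ n ∈ Finset.range (N + 1), G.levelDiff μ T X m r f i l n ω =
      f 0 - f (fieldW μ T X (G.inner T m r i l) ω) := by
  simp only [levelDiff]
  rw [Finset.sum_range_sub fun n => f (fieldW μ T X (G.levelSet T m r i l n) ω),
    levelSet_eq_self _ _ _ _ _ hN G.one_le_order le_rfl, fieldW_self]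
  rfl

/-- Along the possible siblings of the vertices on the path to `v[j]`, the increments telescope to
`f(W(D_j)) - f(W)`. -/
lemma sum_levelDiff_path (i : ℕ → Fin d → ℤ) (ω : Ω) {j : ℕ} (h1 : 1 ≤ j) (hj : j ≤ l) :
    ∑ c ∈ G.path j, ∑ n ∈ Finset.range (G.s c).toNat, G.levelDiff μ T X m r f i (G.p c) n ω =
      f (fieldW μ T X (G.inner T m r i j) ω) - f (fieldW μ T X ∅ ω) := by
  induction j using Nat.strong_induction_on with
  | _ j ih =>
  rcases Nat.lt_or_ge 1 j with h2 | h2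
  · have hlt := G.p_lt' h2
    rw [G.path_eq h2 hj, Finset.sum_insert (G.notMem_path_p h2),
      ih _ hlt (G.p_pos h2 hj) (hlt.le.trans hj), inner_eq_levelSet T m r i h2 hj]
    simp only [levelDiff]
    rw [Finset.sum_range_sub fun n => f (fieldW μ T X (G.levelSet T m r i (G.p j) n) ω),
      levelSet]
    ring
  · obtain rfl : j = 1 := by omega
    rw [path_one, inner_one]
    simp

variable {G}

lemma IsSub.adjDiff_of_nonneg {H : Genogram (l + 1)} (h : G.IsSub H) (hs : 0 ≤ H.s (l + 1))
    (i : ℕ → Fin d → ℤ) :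
    H.adjDiff μ T X m r f i =
      G.levelDiff μ T X m r (iteratedDeriv (l - 1) f) i (H.p (l + 1)) (H.s (l + 1)).toNat := by
  funext ω
  rw [adjDiff, if_pos (H.u_of_nonneg hs), h.outer_last T m r hs, h.inner_last T m r, levelDiff,
    show l + 1 - 2 = l - 1 by omega]

/-- Expansion of a summand of `𝒯_f(G)`. -/
lemma calE_argT [IsProbabilityMeasure μ] {N : ℕ} (hN : T.card ≤ N) (hG : ∀ j, G.s j ≤ N)
    (hS : G.SDefined μ T X m r)
    (hU : ∀ H : Genogram (l + 1), G.IsSub H → 0 ≤ H.s (l + 1) → H.UDefined μ T X m r f)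
    (i : ℕ → Fin d → ℤ) (hi : G.Admissible T m r l i) :
    G.calE μ (G.argT μ T X m r f i) =
      (∫ ω, iteratedDeriv (l - 1) f (fieldW μ T X ∅ ω) ∂μ) * G.calE μ (argS X i) +
        ∑ H ∈ succs N G with 0 ≤ H.s (l + 1),
          (if H.p (l + 1) = l then -1 else 1) * H.calE μ (H.argU μ T X m r f i) := by
  set F := iteratedDeriv (l - 1) f
  set Y := argS X i
  set Δ := G.levelDiff μ T X m r F i
  have h1 := G.one_le_order
  have hEY : G.EDefined μ Y := hS i hi
  have hargU : ∀ H : Genogram (l + 1), G.IsSub H → 0 ≤ H.s (l + 1) →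
      H.argU μ T X m r f i = Function.update Y (l + 1) (Δ (H.p (l + 1)) (H.s (l + 1)).toNat) :=
    fun H h hs => by rw [argU, h.adjDiff_of_nonneg μ T X m r f hs]
  have hdef : ∀ H : Genogram (l + 1), G.IsSub H → 0 ≤ H.s (l + 1) →
      H.EDefined μ (Function.update Y (l + 1) (Δ (H.p (l + 1)) (H.s (l + 1)).toNat)) :=
    fun H h hs => hargU H h hs ▸ hU H h hs i ((h.admissible_iff T m r i le_rfl).2 hi)
  -- children of the last vertex
  have hchild : ∀ n, G.EDefined μ (Function.update Y l fun ω => Y l ω * Δ l n ω) ∧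
      Integrable (Δ l n) μ := fun n => by
    have hc : G.CanAdd l (n : ℤ) := canAdd_child (by positivity)
    have hs : 0 ≤ (add hc).s (l + 1) := by rw [add_s]; positivity
    have := hdef _ (isSub_add hc) hs
    rw [add_p, add_s, Int.toNat_natCast] at this
    exact ((isSub_add hc).calE_of_child (add_p hc) hs Y _ hEY this).2
  -- siblings of the vertices on the path to the last vertex
  have hpl : ∀ c ∈ G.path l, G.p c ≠ l := fun c hc => by
    have := G.p_lt' (G.mem_path.1 hc).2
    have := G.le_of_mem_path hc
    omega
  have hbranch : ∀ c ∈ G.path l, ∀ n ∈ Finset.range (G.s c).toNat,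
      Integrable (Δ (G.p c) n) μ := fun c hc n hn => by
    rw [Finset.mem_range] at hn
    have hc' : G.CanAdd (G.p c) (n : ℤ) := canAdd_sibling hc (by positivity) (by omega)
    have hs : 0 ≤ (add hc').s (l + 1) := by rw [add_s]; positivity
    have := hdef _ (isSub_add hc') hs
    rw [add_p, add_s, Int.toNat_natCast] at this
    refine ((isSub_add hc').calE_of_branch ?_ Y _).2 this
    rw [add_p]
    exact hpl c hc
  -- the sum over the successors of `G` in terms of increments
  obtain ⟨V, hV⟩ : ∃ V : ℕ → ℕ → ℝ, ∀ q n, V q n = if q = l then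
      G.calE μ Y * ∫ ω, Δ l n ω ∂μ - G.calE μ (Function.update Y l fun ω => Y l ω * Δ l n ω)
      else G.calE μ Y * ∫ ω, Δ q n ω ∂μ := ⟨_, fun _ _ => rfl⟩
  have hsum : ∑ H ∈ succs N G with 0 ≤ H.s (l + 1),
      (if H.p (l + 1) = l then -1 else 1) * H.calE μ (H.argU μ T X m r f i) =
      ∑ H ∈ succs N G with 0 ≤ H.s (l + 1), V (H.p (l + 1)) (H.s (l + 1)).toNat := by
    refine Finset.sum_congr rfl fun H hH => ?_
    obtain ⟨hH, hs⟩ := Finset.mem_filter.1 hH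
    have h := ((mem_succs hG).1 hH).1
    rw [hargU H h hs, hV]
    split_ifs with hp
    · have := hdef H h hs
      rw [(h.calE_of_child hp hs Y _ hEY this).1, hp]
      ring
    · rw [(h.calE_of_branch hp Y _).1, one_mul]
  rw [hsum, sum_succs_nonneg hG]
  have hne : ∑ c ∈ G.path l, ∑ n ∈ Finset.range (G.s c).toNat, V (G.p c) n =
      G.calE μ Y * ∑ c ∈ G.path l, ∑ n ∈ Finset.range (G.s c).toNat, ∫ ω, Δ (G.p c) n ω ∂μ := by
    rw [Finset.mul_sum]
    refine Finset.sum_congr rfl fun c hc => ?_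
    rw [Finset.mul_sum]
    exact Finset.sum_congr rfl fun n _ => by rw [hV, if_neg (hpl c hc)]
  -- the last argument of `𝒯_f(G)` and `f(W)` as combinations of increments
  have hlast := fun ω => G.sum_levelDiff_child μ T X m r F i hN ω
  have hpath := fun ω => G.sum_levelDiff_path μ T X m r F i ω h1 le_rfl
  have hW : ∀ ω, F (fieldW μ T X ∅ ω) = F 0 - ∑ n ∈ Finset.range (N + 1), Δ l n ω -
      ∑ c ∈ G.path l, ∑ n ∈ Finset.range (G.s c).toNat, Δ (G.p c) n ω := fun ω => by
    rw [hlast ω, hpath ω]; ring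
  have iW1 : Integrable (fun ω => ∑ n ∈ Finset.range (N + 1), Δ l n ω) μ :=
    integrable_finsetSum _ fun n _ => (hchild n).2
  have iW2 : Integrable (fun ω => ∑ c ∈ G.path l, ∑ n ∈ Finset.range (G.s c).toNat,
      Δ (G.p c) n ω) μ :=
    integrable_finsetSum _ fun c hc => integrable_finsetSum _ fun n hn => hbranch c hc n hn
  have hEW : ∫ ω, F (fieldW μ T X ∅ ω) ∂μ = F 0 - ∑ n ∈ Finset.range (N + 1), ∫ ω, Δ l n ω ∂μ -
      ∑ c ∈ G.path l, ∑ n ∈ Finset.range (G.s c).toNat, ∫ ω, Δ (G.p c) n ω ∂μ := by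
    have iW3 : Integrable (fun ω => F 0 - ∑ n ∈ Finset.range (N + 1), Δ l n ω) μ :=
      (integrable_const _).sub iW1
    simp_rw [hW]
    rw [integral_sub iW3 iW2, integral_sub (integrable_const _) iW1,
      integral_finsetSum _ fun n _ => (hchild n).2,
      integral_finsetSum _ fun c hc => integrable_finsetSum _ fun n hn => hbranch c hc n hn,
      Finset.sum_congr rfl fun c hc => integral_finsetSum _ fun n hn => hbranch c hc n hn]
    simp
  have hT : G.argT μ T X m r f i = Function.update Y l fun ω =>
      ∑ n ∈ Finset.insertNone (Finset.range (N + 1)), (n.elim (F 0) fun _ => -1) *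
        (fun n : Option ℕ => n.elim (Y l) fun n ω => Y l ω * Δ l n ω) n ω := by
    rw [argT]
    congr 1
    funext ω
    rw [Finset.sum_insertNone]
    simp only [Option.elim_none, Option.elim_some]
    rw [← Finset.mul_sum, ← Finset.mul_sum, hlast ω]
    change Y l ω * F _ = _
    ring
  rw [hT, calE_update_sum, Finset.sum_insertNone, hne, hEW]
  · simp only [hV, if_true, Option.elim_none, Option.elim_some, Function.update_eq_self,
      Finset.sum_sub_distrib, ← Finset.mul_sum]
    ring
  · intro n _
    cases n with
    | none => simpa using hEY
    | some n => exact (hchild n).1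

/-- Expansion step: `𝒯_f(G)` in terms of `𝒮(G)` and the `𝒰_f` of the genograms that have one more
vertex, which is non-negative. -/
lemma sumT_eq [IsProbabilityMeasure μ] {N : ℕ} (hN : T.card ≤ N) (hG : ∀ j, G.s j ≤ N)
    (hS : G.SDefined μ T X m r)
    (hU : ∀ H : Genogram (l + 1), G.IsSub H → 0 ≤ H.s (l + 1) → H.UDefined μ T X m r f) :
    G.sumT μ T X m r f =
      G.sumS μ T X m r * (∫ ω, iteratedDeriv (l - 1) f (fieldW μ T X ∅ ω) ∂μ) +
        ∑ H ∈ succs N G with 0 ≤ H.s (l + 1),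
          (if H.p (l + 1) = l then -1 else 1) * H.sumU μ T X m r f := by
  rw [sumT, G.iterSum_congr T m r le_rfl (calE_argT μ T X m r f hN hG hS hU), iterSum_add,
    iterSum_const_mul, iterSum_sum, mul_add, Finset.mul_sum, sumS]
  congr 1
  · ring
  · refine Finset.sum_congr rfl fun H hH => ?_
    have h := ((mem_succs hG).1 (Finset.mem_filter.1 hH).1).1
    rw [sumU, Nat.add_sub_cancel, h.iterSum_eq T m r le_rfl]
    ring

end Genogram

end

/-! ### Sums over all extensions of a genogram -/

section

variable {Ω : Type*} [MeasurableSpace Ω] (μ : Measure Ω) {d : ℕ} (T : Finset (Fin d → ℤ))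
  (X : (Fin d → ℤ) → Ω → ℝ) (m : ℕ) (r : (Fin d → ℤ) → (Fin d → ℤ) → Prop) (f : ℝ → ℝ)

namespace Genogram

lemma sumS_eq_zero {n : ℕ} {H : Genogram n} {j : ℕ} (h2 : 2 ≤ j) (hj : j ≤ n)
    (hs : (T.card : ℤ) < H.s j) : H.sumS μ T X m r = 0 := by
  rw [sumS, H.iterSum_eq_zero T m r le_rfl, mul_zero]
  intro i hi
  have := hi j (Finset.mem_Icc.2 ⟨by omega, hj⟩)
  rw [H.idxRange_eq_empty T m r i h2 hj hs] at this
  simp at this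

lemma sumU_eq_zero {n : ℕ} {H : Genogram n} {j : ℕ} (h2 : 2 ≤ j) (hj : j ≤ n)
    (hs : (T.card : ℤ) < H.s j) : H.sumU μ T X m r f = 0 := by
  rw [sumU, H.iterSum_eq_zero T m r (Nat.sub_le _ _), mul_zero]
  intro i hi
  rcases hj.eq_or_lt with rfl | hlt
  · -- the inner and the outer constraint set of the last vertex are both equal to `T`
    have he := H.idxRange_eq_empty T m r i h2 le_rfl hs
    rw [idxRange, Finset.sdiff_eq_empty_iff_subset] at he
    have he' := (H.inner_subset_outer T m r i (by omega) le_rfl).antisymm he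
    -- the zero function as an empty sum, for linearity in the last argument
    have h0 : H.adjDiff μ T X m r f i = fun ω => ∑ x ∈ (∅ : Finset ℕ), (0 : ℝ) * (0 : ℝ) := by
      funext ω
      rw [adjDiff, if_pos (H.u_of_nonneg (by omega)), he']
      simp
    rw [argU, h0, calE_update_sum (∅ : Finset ℕ) (fun _ => 0) (fun _ _ => 0) _ (by simp)]
    simp
  · have := hi j (Finset.mem_Icc.2 ⟨by omega, by omega⟩)
    rw [H.idxRange_eq_empty T m r i h2 hj hs] at this
    simp at this

variable {l : ℕ} (G : Genogram l)

open Classical in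
/-- The elements of `G.extensions n` all of whose identifiers are at most `N`. -/
noncomputable def boundedExt (N n : ℕ) : Finset (Genogram n) :=
  (bounded n N).filter fun H => H ∈ G.extensions n

variable {G}

lemma mem_boundedExt {N n : ℕ} {H : Genogram n} :
    H ∈ G.boundedExt N n ↔ (∀ j, H.s j ≤ N) ∧ H ∈ G.extensions n := by
  classical
  rw [boundedExt, Finset.mem_filter, mem_bounded]

lemma exists_lt_of_notMem_boundedExt {N n : ℕ} (hN : T.card ≤ N) {H : Genogram n}
    (h : H ∈ G.extensions n) (h' : H ∉ G.boundedExt N n) :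
    ∃ j, 2 ≤ j ∧ j ≤ n ∧ (T.card : ℤ) < H.s j := by
  rw [mem_boundedExt, not_and_or] at h'
  obtain ⟨j, hj⟩ := not_forall.1 (h'.resolve_right (not_not.2 h))
  have hj0 : j ∈ Finset.Icc 1 n := by
    by_contra h0
    rw [H.s_eq_zero j h0] at hj
    omega
  rw [Finset.mem_Icc] at hj0
  refine ⟨j, ?_, hj0.2, by omega⟩
  by_contra h2
  rw [show j = 1 by omega, H.s_root] at hj
  omega

lemma boundedExt_self {N : ℕ} (hG : ∀ j, G.s j ≤ N) : G.boundedExt N l = {G} := by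
  ext H
  rw [mem_boundedExt, Finset.mem_singleton]
  constructor
  · exact fun h => h.2.1.eq
  · rintro rfl
    exact ⟨hG, IsSub.refl _, fun h => absurd h (lt_irrefl _)⟩

lemma boundedExt_succ_self {N : ℕ} :
    G.boundedExt N (l + 1) = (succs N G).filter fun H => 0 ≤ H.s (l + 1) := by
  classical
  ext H
  rw [mem_boundedExt, Finset.mem_filter, succs, Finset.mem_filter, mem_bounded]
  constructor
  · exact fun h => ⟨⟨h.1, h.2.1⟩, h.2.2 (Nat.lt_succ_self l)⟩
  · exact fun h => ⟨h.1.1, h.1.2, fun _ => h.2⟩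

lemma sum_boundedExt_succ {N n : ℕ} (hn : l < n) (V : Genogram (n + 1) → ℝ) :
    ∑ K ∈ G.boundedExt N (n + 1), V K = ∑ H ∈ G.boundedExt N n, ∑ K ∈ succs N H, V K := by
  classical
  have h1 := G.one_le_order
  have hmaps : ∀ K ∈ G.boundedExt N (n + 1),
      K.take n (by omega) (Nat.le_succ n) ∈ G.boundedExt N n := by
    intro K hK
    rw [mem_boundedExt] at hK ⊢
    have hsub := K.take_isSub n (by omega) (Nat.le_succ n)
    refine ⟨fun j => ?_, hK.2.1.take hn.le _ _, fun _ => ?_⟩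
    · rcases le_or_gt j n with hj | hj
      · rw [← hsub.s_eq hj]; exact hK.1 j
      · rw [(K.take n _ _).s_eq_zero j (by rw [Finset.mem_Icc]; omega)]; positivity
    · rw [← hsub.s_eq (by omega)]; exact hK.2.2 (by omega)
  rw [← Finset.sum_fiberwise_of_maps_to hmaps]
  refine Finset.sum_congr rfl fun H hH => Finset.sum_congr ?_ fun _ _ => rfl
  rw [mem_boundedExt] at hH
  ext K
  rw [Finset.mem_filter, mem_boundedExt, succs, Finset.mem_filter, mem_bounded]
  constructor
  · rintro ⟨hK, rfl⟩
    exact ⟨hK.1, K.take_isSub _ _ _⟩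
  · rintro ⟨hK, hHK⟩
    refine ⟨⟨hK, hH.2.1.trans hHK, fun _ => ?_⟩, hHK.take_eq⟩
    rw [hHK.s_eq (by omega)]
    exact hH.2.2 hn

/-- One step of the expansion, for a genogram `H ⊋ G`. -/
lemma coeffB_mul_sumU [IsProbabilityMeasure μ] {n N : ℕ} {H : Genogram (n + 1)} (hn : l ≤ n)
    (hN : T.card ≤ N) (hH : ∀ j, H.s j ≤ N) (hf : ContDiff ℝ (n : WithTop ℕ∞) f)
    (hS : H.SDefined μ T X m r) (hT : H.TDefined μ T X m r f)
    (hU : ∀ K : Genogram (n + 1 + 1), H.IsSub K → K.UDefined μ T X m r f) :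
    H.coeffB G * H.sumU μ T X m r f =
      H.coeffA G * H.sumS μ T X m r * (∫ ω, iteratedDeriv n f (fieldW μ T X ∅ ω) ∂μ) +
        ∑ K ∈ succs N H, K.coeffB G * K.sumU μ T X m r f := by
  have h1 := G.one_le_order
  have hc : H.CanAdd (n + 1) (-1) := canAdd_neg (by omega)
  have hneg : (succs N H).filter (fun K => ¬ 0 ≤ K.s (n + 1 + 1)) = {add hc} := by
    ext K
    rw [Finset.mem_filter, mem_succs hH, Finset.mem_singleton, not_le]
    constructor
    · rintro ⟨⟨hK, -⟩, hs⟩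
      refine hK.ext (isSub_add hc) ?_ ?_
      · rw [add_p, (hK.of_neg hs).1]
      · rw [add_s, (hK.of_neg hs).2.1]
    · rintro rfl
      rw [add_s]
      exact ⟨⟨isSub_add hc, by omega⟩, by norm_num⟩
  have hs : (add hc).s (n + 1 + 1) < 0 := by rw [add_s]; norm_num
  rw [(isSub_add hc).sumU_eq μ T X m r hs hf hT (hU _ (isSub_add hc)),
    sumT_eq μ T X m r f hN hH hS fun K hK _ => hU K hK,
    ← Finset.sum_filter_add_sum_filter_not (succs N H) (fun K => 0 ≤ K.s (n + 1 + 1)), hneg,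
    Finset.sum_singleton, coeffB_of_neg (isSub_add hc) hs]
  have hsum : ∑ K ∈ succs N H with 0 ≤ K.s (n + 1 + 1), K.coeffB G * K.sumU μ T X m r f =
      H.coeffA G * ∑ K ∈ succs N H with 0 ≤ K.s (n + 1 + 1),
        (if K.p (n + 1 + 1) = n + 1 then -1 else 1) * K.sumU μ T X m r f := by
    rw [Finset.mul_sum]
    refine Finset.sum_congr rfl fun K hK => ?_
    obtain ⟨hK, hs⟩ := Finset.mem_filter.1 hK
    rw [coeffB_of_nonneg ((mem_succs hH).1 hK).1 hs]
    ring
  rw [hsum, coeffA_eq hn, Nat.add_sub_cancel]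
  push_cast
  ring

/-- The expansion as an identity between finite sums. -/
lemma sumT_eq_sum_boundedExt [IsProbabilityMeasure μ] {N k : ℕ} (hN : T.card ≤ N)
    (hG : ∀ j, G.s j ≤ N) (hk : l ≤ k) (hf : ContDiff ℝ ((k - 1 : ℕ) : WithTop ℕ∞) f)
    (hS : ∀ n ∈ Finset.Icc l k, ∀ H ∈ G.extensions n, H.SDefined μ T X m r)
    (hT : ∀ n ∈ Finset.Icc l k, ∀ H ∈ G.extensions n, H.TDefined μ T X m r f)
    (hU : ∀ n ∈ Finset.Icc (l + 1) (k + 1), ∀ H ∈ G.extensions n, H.UDefined μ T X m r f) :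
    G.sumT μ T X m r f =
      (∑ n ∈ Finset.Icc l k, ∑ H ∈ G.boundedExt N n, H.coeffA G * H.sumS μ T X m r *
        ∫ ω, iteratedDeriv (n - 1) f (fieldW μ T X ∅ ω) ∂μ) +
      ∑ H ∈ G.boundedExt N (k + 1), H.coeffB G * H.sumU μ T X m r f := by
  induction k, hk using Nat.le_induction with
  | base =>
    have hGS := hS l (by simp) G ⟨IsSub.refl G, fun h => absurd h (lt_irrefl _)⟩
    have hGU : ∀ H : Genogram (l + 1), G.IsSub H → 0 ≤ H.s (l + 1) → H.UDefined μ T X m r f :=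
      fun H h hs => hU (l + 1) (by simp) H ⟨h, fun _ => hs⟩
    rw [Finset.Icc_self, Finset.sum_singleton, boundedExt_self hG, Finset.sum_singleton,
      coeffA_self, one_mul, boundedExt_succ_self, sumT_eq μ T X m r f hN hG hGS hGU]
    congr 1
    refine Finset.sum_congr rfl fun H hH => ?_
    obtain ⟨hH, hs⟩ := Finset.mem_filter.1 hH
    rw [coeffB_of_nonneg ((mem_succs hG).1 hH).1 hs, coeffA_self, mul_one]
  | succ k hk ih =>
    have h1 := G.one_le_order
    rw [ih (hf.of_le (by exact_mod_cast Nat.sub_le_sub_right (Nat.le_succ k) 1))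
      (fun n hn => hS n (Finset.Icc_subset_Icc_right (Nat.le_succ k) hn))
      (fun n hn => hT n (Finset.Icc_subset_Icc_right (Nat.le_succ k) hn))
      (fun n hn => hU n (Finset.Icc_subset_Icc_right (Nat.le_succ _) hn)),
      ← Finset.insert_Icc_right_eq_Icc_add_one (show l ≤ k + 1 by omega),
      Finset.sum_insert (by simp), sum_boundedExt_succ (show l < k + 1 by omega)]
    have hstep : ∀ H ∈ G.boundedExt N (k + 1), H.coeffB G * H.sumU μ T X m r f =
        H.coeffA G * H.sumS μ T X m r * (∫ ω, iteratedDeriv k f (fieldW μ T X ∅ ω) ∂μ) +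
          ∑ K ∈ succs N H, K.coeffB G * K.sumU μ T X m r f := by
      intro H hH
      rw [mem_boundedExt] at hH
      have hmem : k + 1 ∈ Finset.Icc l (k + 1) := Finset.mem_Icc.2 ⟨by omega, le_rfl⟩
      refine coeffB_mul_sumU μ T X m r f hk hN hH.1 hf (hS _ hmem H hH.2) (hT _ hmem H hH.2)
        fun K hK => hU (k + 1 + 1) (Finset.mem_Icc.2 ⟨by omega, le_rfl⟩) K
          ⟨hH.2.1.trans hK, fun _ => ?_⟩
      rw [hK.s_eq (by omega)]
      exact hH.2.2 (by omega)
    rw [Finset.sum_congr rfl hstep, Finset.sum_add_distrib, Nat.add_sub_cancel]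
    ring

end Genogram

end

theorem theoremE2 {Ω : Type*} [MeasurableSpace Ω] (μ : Measure Ω) [IsProbabilityMeasure μ]
    {d : ℕ} (T : Finset (Fin d → ℤ)) (X : (Fin d → ℤ) → Ω → ℝ)
    (hX : ∀ i ∈ T, MemLp (X i) 2 μ) (hσ : 0 < fieldSigma μ T X)
    (m : ℕ) (hm : 1 ≤ m)
    (r : (Fin d → ℤ) → (Fin d → ℤ) → Prop) [IsStrictTotalOrder (Fin d → ℤ) r]
    {l k : ℕ} (G : Genogram l) (hk : l ≤ k)
    (f : ℝ → ℝ) (hf : ContDiff ℝ ((k - 1 : ℕ) : WithTop ℕ∞) f)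
    -- all the expectations that define the quantities below exist
    (hW : ∀ n ∈ Finset.Icc l k,
      Integrable (fun ω => iteratedDeriv (n - 1) f (fieldW μ T X ∅ ω)) μ)
    (hS : ∀ n ∈ Finset.Icc l k, ∀ H ∈ G.extensions n, H.SDefined μ T X m r)
    (hT : ∀ n ∈ Finset.Icc l k, ∀ H ∈ G.extensions n, H.TDefined μ T X m r f)
    (hU : ∀ n ∈ Finset.Icc (l + 1) (k + 1), ∀ H ∈ G.extensions n, H.UDefined μ T X m r f) :
    -- only finitely many terms of the two sums are nonzero
    (∀ n ∈ Finset.Icc l k, {H ∈ G.extensions n | H.sumS μ T X m r ≠ 0}.Finite) ∧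
    {H ∈ G.extensions (k + 1) | H.sumU μ T X m r f ≠ 0}.Finite ∧
    G.sumT μ T X m r f =
      (∑ n ∈ Finset.Icc l k, ∑ᶠ H ∈ G.extensions n,
        H.coeffA G * H.sumS μ T X m r *
          ∫ ω, iteratedDeriv (n - 1) f (fieldW μ T X ∅ ω) ∂μ) +
      ∑ᶠ H ∈ G.extensions (k + 1), H.coeffB G * H.sumU μ T X m r f := by
  obtain ⟨N, hN, hG⟩ : ∃ N : ℕ, T.card ≤ N ∧ ∀ j, G.s j ≤ N := by
    refine ⟨max T.card ((Finset.range (l + 1)).sup fun j => (G.s j).toNat), le_max_left _ _,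
      fun j => ?_⟩
    rcases Nat.lt_or_ge l j with hj | hj
    · rw [G.s_eq_zero j (by rw [Finset.mem_Icc]; omega)]
      positivity
    · have := Finset.le_sup (f := fun j => (G.s j).toNat)
        (Finset.mem_range.2 (show j < l + 1 by omega))
      have := this.trans (le_max_right T.card _)
      omega
  have hzS : ∀ n, ∀ H ∈ G.extensions n, H ∉ G.boundedExt N n → H.sumS μ T X m r = 0 :=
    fun n H h h' => by
      obtain ⟨j, h2, hj, hs⟩ := Genogram.exists_lt_of_notMem_boundedExt T hN h h'
      exact Genogram.sumS_eq_zero μ T X m r h2 hj hs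
  have hzU : ∀ n, ∀ H ∈ G.extensions n, H ∉ G.boundedExt N n → H.sumU μ T X m r f = 0 :=
    fun n H h h' => by
      obtain ⟨j, h2, hj, hs⟩ := Genogram.exists_lt_of_notMem_boundedExt T hN h h'
      exact Genogram.sumU_eq_zero μ T X m r f h2 hj hs
  have hfin : ∀ n, ∀ V : Genogram n → ℝ,
      (∀ H ∈ G.extensions n, H ∉ G.boundedExt N n → V H = 0) →
      ∑ᶠ H ∈ G.extensions n, V H = ∑ H ∈ G.boundedExt N n, V H := by
    intro n V hV
    refine finsum_mem_eq_sum_of_inter_support_eq _ (Set.ext fun H => ?_)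
    refine and_congr_left fun hne => ⟨fun h => ?_, fun h => (Genogram.mem_boundedExt.1 h).2⟩
    by_contra h'
    exact hne (hV H h h')
  refine ⟨fun n _ => ?_, ?_, ?_⟩
  · refine (G.boundedExt N n).finite_toSet.subset fun H hH => ?_
    by_contra h'
    exact hH.2 (hzS n H hH.1 h')
  · refine (G.boundedExt N (k + 1)).finite_toSet.subset fun H hH => ?_
    by_contra h'
    exact hH.2 (hzU (k + 1) H hH.1 h')
  · rw [Genogram.sumT_eq_sum_boundedExt μ T X m r f hN hG hk hf hS hT hU,
      hfin (k + 1) _ fun H h h' => by rw [hzU _ H h h', mul_zero]]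
    congr 1
    refine Finset.sum_congr rfl fun n _ => ?_
    rw [hfin n _ fun H h h' => by rw [hzS _ H h h', mul_zero, zero_mul]]
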